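/- Let $k\ge 2$ and let $F=F(A)$ be the free group with basis $A=\{a_1,\dots,a_k\}$; for $v\in F$ let $|v|$ be the length of the freely reduced word over $A^{\pm1}$ representing $v$. Let $\partial F$ be the set of semi-infinite freely reduced words over $A^{\pm1}$, with the Borel $\sigma$-algebra generated by the cylinders $Cyl_A(v)$ (the set of $\omega\in\partial F$ that begin with $v$), $v\in F$, and let $\mu_A$ be the uniform probability measure on $\partial F$, i.e. $\mu_A(Cyl_A(v))=\frac{1}{2k(2k-1)^{|v|-1}}$ for all $v\in F\setminus\{1\}$. For $\omega\in\partial F$ let $\omega_n\in F$ be its initial segment of length $n$. Let $F$ act by simplicial automorphisms on a simplicial tree $X$ with edges of length $1$, via $\phi:F\to Aut(X)$. The generic stretching factor $\lambda(\phi)=\lambda_A(\phi)$ is the real number such that, for every vertex $x$ of $X$, \[ \lim_{n\to\infty}\frac{d_X(x,\phi(\omega_n)x)}{n}=\lambda(\phi)\quad\text{$\mu_A$-almost everywhere and in } L^1(\partial F,\mu_A). \] (1) If the action $\phi$ is free and without inversions, then the generic stretching factor $\lambda(\phi)$ exists and is a rational number with \[ \lambda(\phi)\ge 1\quad\text{and}\quad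 2k\,\lambda(\phi)\in\mathbb Z\left[\frac{1}{2k-1}\right]. \] (2) $\lambda(\phi)$ is algorithmically computable when $X$ is given as the universal cover of a finite connected graph $\Gamma$ (loops and multiple edges allowed) and $\phi$ is given by an explicit isomorphism $F\to\pi_1(\Gamma,p)$. That is, there is an algorithm (a partial recursive function) which, for every $k\ge 2$, every finite connected graph $\Gamma$ with base-vertex $p$, and every $k$-tuple of closed edge-paths $\gamma_1,\dots,\gamma_k$ at $p$ such that $a_i\mapsto[\gamma_i]$ defines an isomorphism $F\to\pi_1(\Gamma,p)$, when given $\Gamma$, $p$ and $\gamma_1,\dots,\gamma_k$ (as finite lists) as input, halts and outputs integers $a\ge 0$, $b>0$ with $\lambda(\phi)=a/b$, where $\phi$ is the resulting action of $F$ on the universal cover of $\Gamma$ by deck transformations. -/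

import Mathlib

open Filter Topology MeasureTheory CategoryTheory

/-! ### The boundary of a free group and its uniform measure -/

/-- The boundary `∂F` of the free group `F = F(a₁, …, a_k)`: the semi-infinite freely reduced words
over `A^{±1}`. The letter `(i, true)` is `a_i`, and `(i, false)` is `a_i⁻¹`. -/
def FreeBoundary (k : ℕ) : Type :=
  {ω : ℕ → Fin k × Bool // ∀ n, (ω n).1 = (ω (n + 1)).1 → (ω n).2 = (ω (n + 1)).2}

namespace FreeBoundary

/-- The word formed by the first `n` letters of a ray. -/
def initialWord {k : ℕ} (ω : FreeBoundary k) (n : ℕ) : List (Fin k × Bool) :=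
  (List.range n).map ω.1

/-- The vertex `ω_n` at distance `n` from `1` on the ray `ω`. -/
def vertex {k : ℕ} (ω : FreeBoundary k) (n : ℕ) : FreeGroup (Fin k) :=
  FreeGroup.mk (ω.initialWord n)

/-- The cylinder of `v`: all rays that begin with `v`. -/
def cyl {k : ℕ} (v : FreeGroup (Fin k)) : Set (FreeBoundary k) :=
  {ω | ω.vertex v.norm = v}

/-- The Borel `σ`-algebra on `∂F`, generated by the cylinder sets. -/
instance instMeasurableSpace (k : ℕ) : MeasurableSpace (FreeBoundary k) :=
  MeasurableSpace.generateFrom (Set.range cyl)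

/-- `μ` is the uniform probability measure on `∂F`: cylinders of words of equal length have equal
weights. -/
structure IsUniform {k : ℕ} (μ : Measure (FreeBoundary k)) : Prop where
  isProbabilityMeasure : IsProbabilityMeasure μ
  real_cyl : ∀ v : FreeGroup (Fin k), v ≠ 1 →
    μ.real (cyl v) = 1 / (2 * k * (2 * k - 1) ^ (v.norm - 1))

theorem toWord_vertex {k : ℕ} (ω : FreeBoundary k) (n : ℕ) :
    (ω.vertex n).toWord = ω.initialWord n := by
  have h : FreeGroup.IsReduced (ω.initialWord n) := by
    unfold FreeGroup.IsReduced initialWord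
    rw [List.isChain_map, List.isChain_iff_getElem]
    intro i hi
    simpa using ω.2 i
  rw [vertex, FreeGroup.toWord_mk]
  exact h.reduce_eq

theorem mem_cyl_iff {k : ℕ} (ω : FreeBoundary k) (v : FreeGroup (Fin k)) :
    ω ∈ cyl v ↔ ω.initialWord v.toWord.length = v.toWord := by
  rw [← toWord_vertex, FreeGroup.toWord_inj]
  rfl

theorem isPiSystem_cyl (k : ℕ) : IsPiSystem (Set.range (cyl (k := k))) := by
  have key : ∀ v w : FreeGroup (Fin k), v.toWord.length ≤ w.toWord.length →
      (cyl v ∩ cyl w).Nonempty → cyl w ⊆ cyl v := by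
    rintro v w hvw ⟨ω, hv, hw⟩ ω' hw'
    rw [mem_cyl_iff] at *
    have h := hw'.trans hw.symm
    have h2 := congrArg (List.take v.toWord.length) h
    simp only [initialWord, ← List.map_take, List.take_range, min_eq_left hvw] at h2
    exact h2.trans hv
  rintro _ ⟨v, rfl⟩ _ ⟨w, rfl⟩ h
  rcases le_total v.toWord.length w.toWord.length with hvw | hvw
  · exact ⟨w, (Set.inter_eq_right.2 (key v w hvw h)).symm⟩
  · rw [Set.inter_comm] at h ⊢
    exact ⟨v, (Set.inter_eq_right.2 (key w v hvw h)).symm⟩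

theorem IsUniform.eq {k : ℕ} {μ ν : Measure (FreeBoundary k)}
    (hμ : IsUniform μ) (hν : IsUniform ν) : μ = ν := by
  have := hμ.isProbabilityMeasure
  have := hν.isProbabilityMeasure
  refine ext_of_generate_finite _ rfl (isPiSystem_cyl k) ?_ (by simp)
  rintro _ ⟨v, rfl⟩
  by_cases hv : v = 1
  · subst hv
    have : cyl (1 : FreeGroup (Fin k)) = Set.univ := by
      ext ω
      simp [mem_cyl_iff, initialWord]
    simp [this]
  · have := (hμ.real_cyl v hv).trans (hν.real_cyl v hv).symm
    rwa [measureReal_eq_measureReal_iff] at this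

theorem exists_isUniform {k : ℕ} (hk : 2 ≤ k) : ∃ μ : Measure (FreeBoundary k), IsUniform μ := by
  classical
  obtain ⟨m, hm⟩ : ∃ m, m + 1 = 2 * k := ⟨2 * k - 1, by omega⟩
  have : Nonempty (Fin m) := ⟨⟨0, by omega⟩⟩
  have : Nonempty (Fin k) := ⟨⟨0, by omega⟩⟩
  have hcard : ∀ a : Fin k × Bool,
      Fintype.card {b : Fin k × Bool // a.1 = b.1 → a.2 = b.2} = m := by
    intro a
    have h1 := Fintype.card_subtype_compl (fun b : Fin k × Bool => b = (a.1, !a.2))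
    rw [Fintype.card_subtype_eq, Fintype.card_prod, Fintype.card_fin, Fintype.card_bool] at h1
    have h2 : Fintype.card {b : Fin k × Bool // a.1 = b.1 → a.2 = b.2}
        = Fintype.card {b : Fin k × Bool // ¬ b = (a.1, !a.2)} := by
      refine Fintype.card_congr (Equiv.subtypeEquivRight ?_)
      rintro ⟨i, s⟩
      obtain ⟨j, t⟩ := a
      cases s <;> cases t <;> simp [eq_comm]
    omega
  let e : ∀ a : Fin k × Bool, Fin m ≃ {b : Fin k × Bool // a.1 = b.1 → a.2 = b.2} :=
    fun a => (Fintype.equivFinOfCardEq (hcard a)).symm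
  let ray : (Fin k × Bool) × (ℕ → Fin m) → FreeBoundary k := fun x =>
    ⟨fun n => Nat.rec x.1 (fun n a => (e a (x.2 n)).1) n, fun n => (e _ (x.2 n)).2⟩
  let P : Measure ((Fin k × Bool) × (ℕ → Fin m)) :=
    (PMF.uniformOfFintype (Fin k × Bool)).toMeasure.prod
      (Measure.infinitePi fun _ : ℕ => (PMF.uniformOfFintype (Fin m)).toMeasure)
  have hpre : ∀ v : FreeGroup (Fin k), v ≠ 1 → ∃ (a : Fin k × Bool) (b : ℕ → Fin m),
      ray ⁻¹' cyl v = {a} ×ˢ (Set.pi (Finset.range (v.norm - 1)) fun i => {b i}) := by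
    intro v hv
    have hlen : 0 < v.toWord.length := by
      rw [List.length_pos_iff]
      simpa using hv
    have hred : FreeGroup.IsReduced v.toWord := FreeGroup.isReduced_toWord
    unfold FreeGroup.IsReduced at hred
    rw [List.isChain_iff_getElem] at hred
    have hb : ∀ i, ∃ b : Fin m, ∀ hi : i + 1 < v.toWord.length,
        (e v.toWord[i] b).1 = v.toWord[i + 1] := by
      intro i
      by_cases hi : i + 1 < v.toWord.length
      · exact ⟨(e v.toWord[i]).symm ⟨v.toWord[i + 1], hred i hi⟩, fun _ => by simp⟩
      · exact ⟨Classical.arbitrary _, fun h => absurd h hi⟩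
    choose b hb using hb
    refine ⟨v.toWord[0], b, ?_⟩
    ext x
    have hmem : ray x ∈ cyl v ↔ ∀ i (hi : i < v.toWord.length), (ray x).1 i = v.toWord[i] := by
      rw [mem_cyl_iff]
      constructor
      · intro h i hi
        have := List.getElem_of_eq h (i := i) (by simpa [initialWord] using hi)
        simpa [initialWord] using this
      · intro h
        apply List.ext_getElem (by simp [initialWord])
        intro i h1 h2
        simpa [initialWord] using h i h2
    rw [Set.mem_preimage, hmem]
    simp only [Set.mem_prod, Set.mem_singleton_iff, Set.mem_pi, Finset.coe_range, Set.mem_Iio,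
      FreeGroup.norm]
    constructor
    · intro h
      refine ⟨h 0 hlen, fun i hi => ?_⟩
      have h1 : (ray x).1 i = v.toWord[i] := h i (by omega)
      have h2 : (e ((ray x).1 i) (x.2 i)).1 = v.toWord[i + 1] := h (i + 1) (by omega)
      rw [h1, ← hb i (by omega)] at h2
      exact (e _).injective (Subtype.ext h2)
    · rintro ⟨h0, h⟩ i
      induction i with
      | zero => intro _; exact h0
      | succ i ih =>
        intro hi
        have h1 := ih (by omega)
        change (e ((ray x).1 i) (x.2 i)).1 = _
        rw [h1, h i (by omega), hb i hi]
  have hmeas : Measurable ray := by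
    refine measurable_generateFrom ?_
    rintro _ ⟨v, rfl⟩
    by_cases hv : v = 1
    · subst hv
      have : cyl (1 : FreeGroup (Fin k)) = Set.univ := by
        ext ω
        simp [mem_cyl_iff, initialWord]
      simp [this]
    · obtain ⟨a, b, h⟩ := hpre v hv
      rw [h]
      exact (MeasurableSet.singleton a).prod
        (MeasurableSet.pi (Set.to_countable _) fun i _ => MeasurableSet.singleton _)
  refine ⟨P.map ray, Measure.isProbabilityMeasure_map hmeas.aemeasurable, fun v hv => ?_⟩
  obtain ⟨a, b, h⟩ := hpre v hv
  have hc : MeasurableSet (cyl v) := MeasurableSpace.measurableSet_generateFrom ⟨v, rfl⟩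
  rw [map_measureReal_apply hmeas hc, h, measureReal_prod_prod, measureReal_def, measureReal_def,
    Measure.infinitePi_pi _ (fun i _ => MeasurableSet.singleton _),
    PMF.toMeasure_apply_singleton _ _ (MeasurableSet.singleton _)]
  simp_rw [PMF.toMeasure_apply_singleton _ _ (MeasurableSet.singleton _)]
  have hmR : (m : ℝ) = 2 * k - 1 := by
    have := congrArg (Nat.cast (R := ℝ)) hm
    push_cast at this
    linarith
  rw [← hmR]
  simp [PMF.uniformOfFintype_apply, mul_comm]

/-- The uniform probability measure on `∂F` corresponding to the basis `A`; it is the only measure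
satisfying `IsUniform`, by `IsUniform.eq`. -/
noncomputable def uniformMeasure {k : ℕ} (hk : 2 ≤ k) : Measure (FreeBoundary k) :=
  (exists_isUniform hk).choose

theorem isUniform_uniformMeasure {k : ℕ} (hk : 2 ≤ k) : IsUniform (uniformMeasure hk) :=
  (exists_isUniform hk).choose_spec

end FreeBoundary

/-! ### Generic stretching factors -/

/-- `lam` is the generic stretching factor of the semi-norm `N` on `F` (the pull-back to `F` of a
semi-norm on the target group): `N(ω_n)/n → lam` almost everywhere and in `L¹` for the uniform
measure. -/
def IsGenericStretchingFactor {k : ℕ} (hk : 2 ≤ k) (N : FreeGroup (Fin k) → ℝ) (lam : ℝ) : Prop :=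
  (∀ᵐ ω ∂(FreeBoundary.uniformMeasure hk),
      Tendsto (fun n : ℕ => N (ω.vertex n) / n) atTop (𝓝 lam)) ∧
    Tendsto (fun n : ℕ => eLpNorm (fun ω : FreeBoundary k => N (ω.vertex n) / n - lam) 1
      (FreeBoundary.uniformMeasure hk)) atTop (𝓝 0)

/-- `lam` is the generic stretching factor of an action of `F` on a graph `X`: for every base-point
`x`, it is the generic stretching factor of the semi-norm `|g|_x = d(x, g x)`. -/
def IsActionStretchingFactor {k : ℕ} (hk : 2 ≤ k) {V : Type*} {X : SimpleGraph V}
    (φ : FreeGroup (Fin k) →* (X ≃g X)) (lam : ℝ) : Prop :=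
  ∀ x : V, IsGenericStretchingFactor hk (fun g => (X.dist x (φ g x) : ℝ)) lam

/-- A free action on (the vertices of) a graph. -/
def IsFreeAction {G V : Type*} [Group G] {X : SimpleGraph V} (φ : G →* (X ≃g X)) : Prop :=
  ∀ (g : G) (v : V), φ g v = v → g = 1

/-- No group element exchanges the two ends of an edge. -/
def WithoutInversions {G V : Type*} [Group G] {X : SimpleGraph V} (φ : G →* (X ≃g X)) : Prop :=
  ∀ (g : G) (u v : V), X.Adj u v → ¬ (φ g u = v ∧ φ g v = u)

/-! ### Finite graphs, fundamental groups and universal covers -/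

/-- A finite graph, loops and multiple edges allowed: the vertices are `0, …, numVertices - 1`, the
edges are `0, …, numEdges - 1`, and every edge has an orientation chosen. -/
structure FiniteGraph where
  numVertices : ℕ
  numEdges : ℕ
  src : Fin numEdges → Fin numVertices
  tgt : Fin numEdges → Fin numVertices

namespace FiniteGraph

/-- The vertex set of `Γ`, carrying the quiver of its oriented edges. -/
def Vertex (Γ : FiniteGraph) : Type := Fin Γ.numVertices

instance instQuiverVertex (Γ : FiniteGraph) : Quiver Γ.Vertex where
  Hom u v := {e : Fin Γ.numEdges // Γ.src e = u ∧ Γ.tgt e = v}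

/-- Edge-paths in `Γ`: each edge may be crossed in either direction. -/
abbrev EdgePath (Γ : FiniteGraph) (u v : Γ.Vertex) : Type :=
  Quiver.Path (V := Quiver.Symmetrify Γ.Vertex) u v

/-- Any two vertices are joined by an edge-path. -/
def IsConnected (Γ : FiniteGraph) : Prop :=
  Nonempty Γ.Vertex ∧ ∀ u v : Γ.Vertex, Nonempty (Γ.EdgePath u v)

/-- The homotopy classes (rel endpoints) of edge-paths from `u` to `v`: the morphisms of the free
groupoid on `Γ`, which is its fundamental groupoid. -/
abbrev HomotopyClass (Γ : FiniteGraph) (u v : Γ.Vertex) : Type :=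
  (Quiver.FreeGroupoid.of Γ.Vertex).obj u ⟶ (Quiver.FreeGroupoid.of Γ.Vertex).obj v

/-- The homotopy class of a single oriented edge. -/
def edgeClass {Γ : FiniteGraph} {u v : Γ.Vertex} (e : u ⟶ v) : Γ.HomotopyClass u v :=
  (Quiver.FreeGroupoid.of Γ.Vertex).map e

/-- The homotopy class of an edge-path: its image in the free groupoid, which is the quotient of the
path category by the reductions `e e⁻¹ ~ 1`. -/
def pathClass {Γ : FiniteGraph} {u v : Γ.Vertex} (γ : Γ.EdgePath u v) : Γ.HomotopyClass u v :=
  (CategoryTheory.Quotient.functor (Quiver.FreeGroupoid.redStep (V := Γ.Vertex))).map γ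

/-- The fundamental group `π₁(Γ, p)`, with multiplication induced by concatenation. -/
abbrev FundamentalGroup (Γ : FiniteGraph) (p : Γ.Vertex) : Type := Γ.HomotopyClass p p

/-- The vertices of the universal cover of `(Γ, p)`: homotopy classes of edge-paths issuing
from `p`. -/
abbrev CoverVertex (Γ : FiniteGraph) (p : Γ.Vertex) : Type :=
  Σ v : Γ.Vertex, Γ.HomotopyClass p v

/-- The universal cover of `(Γ, p)`: there is an edge from `[γ]` to `[γe]` for each path `γ` issuing
from `p` and each edge `e` which `γ` can be continued with. -/
def universalCover (Γ : FiniteGraph) (p : Γ.Vertex) : SimpleGraph (Γ.CoverVertex p) :=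
  SimpleGraph.fromRel fun x y => ∃ e : x.1 ⟶ y.1, x.2 ≫ edgeClass e = y.2

/-- The action of `π₁(Γ, p)` on the universal cover by deck transformations `[γ] ↦ [cγ]`. -/
def deckAction (Γ : FiniteGraph) (p : Γ.Vertex) :
    Γ.FundamentalGroup p →* (Γ.universalCover p ≃g Γ.universalCover p) where
  toFun c :=
    { toFun := fun x => ⟨x.1, c ≫ x.2⟩
      invFun := fun x => ⟨x.1, Groupoid.inv c ≫ x.2⟩
      left_inv := fun x => by simp [← Category.assoc]
      right_inv := fun x => by simp [← Category.assoc]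
      map_rel_iff' := by
        rintro ⟨u, x⟩ ⟨v, y⟩
        simp only [universalCover, SimpleGraph.fromRel_adj, Equiv.coe_fn_mk, Category.assoc,
          cancel_epi]
        refine and_congr_left fun _ => not_congr ?_
        rw [Sigma.mk.injEq, Sigma.mk.injEq]
        refine and_congr_right fun h => ?_
        cases h
        rw [heq_iff_eq, heq_iff_eq, cancel_epi] }
  map_one' := RelIso.ext fun x => Sigma.ext rfl (heq_of_eq (Category.id_comp x.2))
  map_mul' c d := RelIso.ext fun x => Sigma.ext rfl (heq_of_eq (Category.assoc c d x.2))

end FiniteGraph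

/-- An isomorphism between `F = F(a₁, …, a_k)` and the fundamental group of a finite connected graph
`Γ`, given explicitly by closed edge-paths at `p` that represent the images of `a₁, …, a_k`. -/
structure MarkedGraph (k : ℕ) where
  graph : FiniteGraph
  connected : graph.IsConnected
  base : graph.Vertex
  loop : Fin k → graph.EdgePath base base
  bijective : Function.Bijective
    (FreeGroup.lift fun i => (FiniteGraph.pathClass (loop i) : graph.FundamentalGroup base))

namespace MarkedGraph

/-- The isomorphism `F → π₁(Γ, p)`. -/
noncomputable def marking {k : ℕ} (M : MarkedGraph k) :
    FreeGroup (Fin k) ≃* M.graph.FundamentalGroup M.base :=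
  MulEquiv.ofBijective _ M.bijective

/-- The action of `F`, through the isomorphism, on the universal cover of `Γ`. -/
noncomputable def action {k : ℕ} (M : MarkedGraph k) :
    FreeGroup (Fin k) →* (M.graph.universalCover M.base ≃g M.graph.universalCover M.base) :=
  (M.graph.deckAction M.base).comp M.marking.toMonoidHom

/-- The sequence of edges of an edge-path; `(e, true)` means that `e` is crossed along its
orientation, and `(e, false)` that it is crossed backwards. -/
def pathCode {Γ : FiniteGraph} {u : Γ.Vertex} :
    {v : Γ.Vertex} → Γ.EdgePath u v → List (ℕ × Bool)
  | _, Quiver.Path.nil => []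
  | _, Quiver.Path.cons γ (Sum.inl e) => pathCode γ ++ [((e.1 : Fin Γ.numEdges).1, true)]
  | _, Quiver.Path.cons γ (Sum.inr e) => pathCode γ ++ [((e.1 : Fin Γ.numEdges).1, false)]

/-- Finite descriptions of marked graphs: number of vertices, list of the pairs (initial vertex,
terminal vertex) of the edges, base-vertex, and list of the closed edge-paths that represent the
images of `a₁, …, a_k`. -/
abbrev Code : Type := ℕ × List (ℕ × ℕ) × ℕ × List (List (ℕ × Bool))

/-- The description of `M`, which serves as the input of an algorithm. -/
def code {k : ℕ} (M : MarkedGraph k) : Code :=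
  (M.graph.numVertices,
    List.ofFn fun e => ((M.graph.src e : ℕ), (M.graph.tgt e : ℕ)),
    (M.base : Fin M.graph.numVertices).1,
    List.ofFn fun i => pathCode (M.loop i))

end MarkedGraph

/-! Reduction to free groups. Since the action is free and without inversions, the edges of the tree
can be oriented and labelled by their orbits. Reading labels along the path from x to gx gives an
injective homomorphism c from F to the free group on the labels, with |c(g)| = d(x, gx)
(`SimpleGraph.IsTree.exists_hom_norm_eq_dist`). Another base-point changes the distance by a bounded
amount, so only N(w) = |c(w)| matters.

Rationality. Let D bound all |c(a_i)|. Only finitely many g have |c(g)| ≤ D, so there is m such that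
|g| ≥ m forces |c(g)| > D. The four-point condition then gives |c(ay)| + |c(yb)| = |c(ayb)| + |c(y)|
for long reduced words ayb with letters a, b. Hence deleting the first letter changes N by an amount
that depends only on the first m + 1 letters (`FreeGroup.norm_increment_eq`). The uniform
distributions on reduced words are invariant under deleting the first letter, so the mean of N
eventually grows by a constant λ per letter. This λ is an average of integers over the 2k(2k-1)^m
reduced words of length m + 1.

Convergence. Conditioning on a prefix of bounded length shifts the mean of N by a bounded amount
only, so the variance of N grows at most linearly (`FreeGroup.exists_average_sq_le`). This yields
almost sure convergence along the squares. The Lipschitz property of N fills the gaps, and dominated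
convergence gives the limit in L¹.

Lower bound. The image of c has at most k non-trivial Schreier generators, and rewriting in them
does not lengthen words (`FreeGroup.exists_hom_norm_le`). So at most 2(2k-1)^r elements satisfy
|c(g)| ≤ r. Most words of length n therefore have an image of length at least n - O(1), and λ ≥ 1.

Computability. For a finite graph, c is the explicit map to the free group on the edges. It has a
left inverse, which can be found by unbounded search; its word lengths bound |g| by a multiple of
|c(g)|, and this makes m explicit. -/

/-! ### Cancellation in free groups and the four-point condition -/

namespace FreeGroup

/-- The length of the longest common prefix of two lists. -/
def commonPrefixLength {β : Type*} [DecidableEq β] : List β → List β → ℕ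
  | a :: u, b :: v => if a = b then commonPrefixLength u v + 1 else 0
  | _, _ => 0

/-- The common prefix length is the Gromov product at the root of the tree of words; its ultrametric
inequality is the source of the four-point condition. -/
theorem min_commonPrefixLength_le {β : Type*} [DecidableEq β] (u v w : List β) :
    min (commonPrefixLength u v) (commonPrefixLength v w) ≤ commonPrefixLength u w := by
  induction u generalizing v w with
  | nil => simp [commonPrefixLength]
  | cons a u ih =>
    cases v with
    | nil => simp [commonPrefixLength]
    | cons b v =>
      cases w with
      | nil => simp [commonPrefixLength]
      | cons c w =>
        have := ih v w
        simp only [commonPrefixLength]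
        split_ifs <;> simp_all

theorem commonPrefixLength_comm {β : Type*} [DecidableEq β] (u v : List β) :
    commonPrefixLength u v = commonPrefixLength v u := by
  induction u generalizing v with
  | nil => cases v <;> simp [commonPrefixLength]
  | cons a u ih =>
    cases v with
    | nil => simp [commonPrefixLength]
    | cons b v => simp [commonPrefixLength, ih v, eq_comm]

variable {E : Type*} [DecidableEq E]

/-- Exactly the common prefix cancels: once the first letters differ, the concatenation is already
reduced. -/
theorem length_reduce_invRev_append {u v : List (E × Bool)} (hu : IsReduced u) (hv : IsReduced v) :
    (reduce (invRev u ++ v)).length + 2 * commonPrefixLength u v = u.length + v.length := by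
  induction u generalizing v with
  | nil => simp [commonPrefixLength, hv.reduce_eq]
  | cons a u ih =>
    cases v with
    | nil =>
      simp [commonPrefixLength, reduce_invRev, hu.reduce_eq]
    | cons b v =>
      simp only [commonPrefixLength]
      split_ifs with h
      · subst h
        have h1 : reduce (invRev (a :: u) ++ a :: v) = reduce (invRev u ++ v) := by
          apply reduce.sound
          rw [← mul_mk, ← mul_mk, ← inv_mk, ← inv_mk,
            show a :: u = [a] ++ u from rfl, show a :: v = [a] ++ v from rfl, ← mul_mk, ← mul_mk]
          group
        rw [h1]
        have := ih (List.IsChain.tail hu) (List.IsChain.tail hv)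
        simp only [List.tail_cons] at this
        simp only [List.length_cons]
        omega
      · have h1 : IsReduced (invRev (a :: u) ++ b :: v) := by
          unfold IsReduced
          rw [List.isChain_append]
          refine ⟨?_, hv, ?_⟩
          · have : reduce (invRev (a :: u)) = invRev (a :: u) := by
              rw [reduce_invRev, hu.reduce_eq]
            exact isReduced_iff_reduce_eq.2 this
          · intro x hx y hy
            simp [invRev] at hx hy
            subst hx hy
            rintro h1
            by_contra h2
            apply h
            ext
            · exact h1
            · simp only at h2
              revert h2
              cases a.2 <;> cases b.2 <;> simp
        rw [h1.reduce_eq]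
        simp

theorem norm_inv_mul_add (g h : FreeGroup E) :
    (g⁻¹ * h).norm + 2 * commonPrefixLength g.toWord h.toWord = g.norm + h.norm := by
  have := length_reduce_invRev_append (isReduced_toWord (x := g)) (isReduced_toWord (x := h))
  rwa [← toWord_inv, ← toWord_mul] at this

/-- The four-point condition in the Cayley tree of a free group. -/
theorem norm_add_norm_eq_of_lt (a g h : FreeGroup E)
    (hlt : a.norm + (g⁻¹ * h).norm < g.norm + (a⁻¹ * h).norm) :
    g.norm + (a⁻¹ * h).norm = h.norm + (a⁻¹ * g).norm := by
  have h1 := norm_inv_mul_add a g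
  have h2 := norm_inv_mul_add a h
  have h3 := norm_inv_mul_add g h
  -- The hypothesis says (a|h) < (g|h) for Gromov products. The two ultrametric inequalities then
  -- force (a|g) = (a|h), which is the claim.
  have h4 := min_commonPrefixLength_le a.toWord g.toWord h.toWord
  have h5 := min_commonPrefixLength_le a.toWord h.toWord g.toWord
  have h6 := commonPrefixLength_comm h.toWord g.toWord
  omega

/-- The four-point condition for the points 1, a, ay, ayb. -/
theorem norm_mul_add_norm_mul_eq_of_lt (a y b : FreeGroup E)
    (hlt : a.norm + b.norm < (a * y).norm + (y * b).norm) :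
    (a * y).norm + (y * b).norm = (a * y * b).norm + y.norm := by
  have := norm_add_norm_eq_of_lt a (a * y) (a * y * b)
  simp only [mul_assoc, mul_inv_rev, inv_mul_cancel_left] at this
  simpa [mul_assoc] using this hlt

theorem norm_map_mk_le {F : Type*} (c : FreeGroup F →* FreeGroup E) {D : ℕ} (hD : ∀ i, (c (of i)).norm ≤ D)
    (w : List (F × Bool)) : (c (mk w)).norm ≤ D * w.length := by
  induction w with
  | nil => simp [← one_eq_mk]
  | cons a w ih =>
    rw [← List.singleton_append, ← mul_mk, _root_.map_mul]
    refine (norm_mul_le _ _).trans ?_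
    have : (c (mk [a])).norm ≤ D := by
      obtain ⟨i, s⟩ := a
      cases s
      · have h : (mk [(i, false)] : FreeGroup F) = (of i)⁻¹ := by simp [of, invRev]
        rw [h, _root_.map_inv, norm_inv_eq]
        exact hD i
      · exact hD i
    simp only [List.singleton_append, List.length_cons]
    nlinarith

variable {F : Type*} [DecidableEq F]

theorem norm_map_le (c : FreeGroup F →* FreeGroup E) {D : ℕ} (hD : ∀ i, (c (of i)).norm ≤ D)
    (g : FreeGroup F) : (c g).norm ≤ D * g.norm := by
  have h := norm_map_mk_le c hD g.toWord
  rwa [mk_toWord] at h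

/-- Far away from the base-point the increments of `|c(·)|` depend only on a prefix. -/
theorem norm_increment_eq (c : FreeGroup F →* FreeGroup E) {D m : ℕ}
    (hD : ∀ i, (c (of i)).norm ≤ D) (hm : ∀ g : FreeGroup F, m ≤ g.norm → D < (c g).norm)
    {w : List (F × Bool)} (hw : IsReduced w) (hlen : m + 1 ≤ w.length) :
    ((c (mk w)).norm : ℝ) - (c (mk w.tail)).norm =
      (c (mk (w.take (m + 1)))).norm - (c (mk (w.take (m + 1)).tail)).norm := by
  induction w using List.reverseRecOn with
  | nil => simp at hlen
  | append_singleton w b ih =>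
    by_cases h1 : m + 1 = (w ++ [b]).length
    · rw [h1, List.take_length]
    have h2 : m + 1 ≤ w.length := by simp at h1 hlen; omega
    -- The prefix does not see the new last letter b, so it suffices that w = ay and ayb have equal
    -- increments. Both ay and yb have length at least m, so their images are longer than D, while
    -- the images of a and b are not; this is the strict inequality that the four-point condition
    -- needs.
    rw [List.take_append_of_le_length h2, ← ih (hw.infix ⟨[], [b], by simp⟩) h2]
    obtain ⟨a, y, rfl⟩ : ∃ a y, w = a :: y := by
      cases w with
      | nil => simp at h2
      | cons a y => exact ⟨a, y, rfl⟩
    have hnorm : ∀ u : List (F × Bool), u <:+: (a :: y ++ [b]) → (mk u).norm = u.length := by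
      intro u hu
      rw [norm, toWord_mk, (hw.infix hu).reduce_eq]
    have h3 : D < (c (mk [a] * mk y)).norm := by
      apply hm
      rw [mul_mk, hnorm _ ⟨[], [b], by simp⟩]
      simp at h2 ⊢; omega
    have h4 : D < (c (mk y * mk [b])).norm := by
      apply hm
      rw [mul_mk, hnorm _ ⟨[a], [], by simp⟩]
      simp at h2 ⊢; omega
    have h5 : ∀ a : F × Bool, (c (mk [a])).norm ≤ D := by
      intro a
      simpa using norm_map_mk_le c hD [a]
    have := norm_mul_add_norm_mul_eq_of_lt (c (mk [a])) (c (mk y)) (c (mk [b])) (by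
      rw [← _root_.map_mul, ← _root_.map_mul]
      have := h5 a; have := h5 b
      omega)
    simp only [← _root_.map_mul, mul_mk] at this
    simp only [List.cons_append, List.nil_append, List.tail_cons] at this ⊢
    have h6 := congrArg (Nat.cast (R := ℝ)) this
    push_cast at h6
    linarith

end FreeGroup

/-! ### Averages over reduced words -/

namespace FreeGroup

section Averages

variable {k : ℕ}

/-- The letters which may follow the letter `a` in a reduced word. -/
def followers (a : Fin k × Bool) : Finset (Fin k × Bool) := Finset.univ.erase (a.1, !a.2)

theorem mem_followers {a b : Fin k × Bool} : b ∈ followers a ↔ (a.1 = b.1 → a.2 = b.2) := by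
  obtain ⟨i, s⟩ := a
  obtain ⟨j, t⟩ := b
  cases s <;> cases t <;> simp [followers, eq_comm]

theorem sum_followers (a : Fin k × Bool) (x : Fin k × Bool → ℝ) :
    ∑ b ∈ followers a, x b = ∑ b, x b - x (a.1, !a.2) := by
  rw [followers, Finset.sum_erase_eq_sub (Finset.mem_univ _)]

theorem card_followers (a : Fin k × Bool) : ((followers a).card : ℝ) = 2 * k - 1 := by
  have := sum_followers a fun _ => 1
  simpa [mul_comm] using this

/-- The reduced words of length `n + 1` which begin with the letter `a`. -/
def wordsFrom : ℕ → Fin k × Bool → Finset (List (Fin k × Bool))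
  | 0, a => {[a]}
  | n + 1, a => (followers a).biUnion fun b =>
      (wordsFrom n b).map ⟨List.cons a, List.cons_injective⟩

theorem mem_wordsFrom {n : ℕ} {a : Fin k × Bool} {w : List (Fin k × Bool)} :
    w ∈ wordsFrom n a ↔ IsReduced w ∧ w.length = n + 1 ∧ w.head? = some a := by
  induction n generalizing a w with
  | zero =>
    rw [wordsFrom, Finset.mem_singleton]
    constructor
    · rintro rfl
      simp
    · rintro ⟨-, h1, h2⟩
      obtain ⟨b, rfl⟩ := List.length_eq_one_iff.1 h1
      simpa using h2
  | succ n ih =>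
    simp only [wordsFrom, Finset.mem_biUnion, Finset.mem_map, ih, Function.Embedding.coeFn_mk]
    constructor
    · rintro ⟨b, hb, u, ⟨hu, hlen, hhead⟩, rfl⟩
      cases u with
      | nil => simp at hlen
      | cons c u =>
        obtain rfl : c = b := by simpa using hhead
        refine ⟨?_, by simpa using hlen, rfl⟩
        rw [isReduced_cons_cons]
        exact ⟨mem_followers.1 hb, hu⟩
    · rintro ⟨hw, hlen, hhead⟩
      obtain _ | ⟨c, _ | ⟨b, u⟩⟩ := w
      · simp at hlen
      · simp at hlen
      · obtain rfl : c = a := by simpa using hhead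
        rw [isReduced_cons_cons] at hw
        exact ⟨b, mem_followers.2 hw.1, b :: u, ⟨hw.2, by simpa using hlen, rfl⟩, rfl⟩

theorem sum_wordsFrom_succ (n : ℕ) (a : Fin k × Bool) (f : List (Fin k × Bool) → ℝ) :
    ∑ w ∈ wordsFrom (n + 1) a, f w = ∑ b ∈ followers a, ∑ w ∈ wordsFrom n b, f (a :: w) := by
  rw [wordsFrom, Finset.sum_biUnion]
  · simp
  · intro b _ c _ hbc
    rw [Function.onFun, Finset.disjoint_left]
    intro w hw hw'
    simp only [Finset.mem_map, mem_wordsFrom, Function.Embedding.coeFn_mk] at hw hw'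
    obtain ⟨u, hu, rfl⟩ := hw
    obtain ⟨v, hv, h⟩ := hw'
    simp only [List.cons.injEq, true_and] at h
    subst h
    exact hbc (Option.some.inj (hu.2.2.symm.trans hv.2.2))

/-- The average of `f` over the reduced words of length `n + 1` which begin with `a`. -/
noncomputable def averageFrom (n : ℕ) (a : Fin k × Bool) (f : List (Fin k × Bool) → ℝ) : ℝ :=
  (∑ w ∈ wordsFrom n a, f w) / (2 * k - 1) ^ n

/-- The average of `f` over all reduced words of length `n + 1`. -/
noncomputable def average (n : ℕ) (f : List (Fin k × Bool) → ℝ) : ℝ :=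
  (∑ a, averageFrom n a f) / (2 * k)

theorem averageFrom_zero (a : Fin k × Bool) (f : List (Fin k × Bool) → ℝ) :
    averageFrom 0 a f = f [a] := by
  simp [averageFrom, wordsFrom]

theorem averageFrom_succ (n : ℕ) (a : Fin k × Bool) (f : List (Fin k × Bool) → ℝ) :
    averageFrom (n + 1) a f =
      (∑ b ∈ followers a, averageFrom n b fun w => f (a :: w)) / (2 * k - 1) := by
  simp only [averageFrom, sum_wordsFrom_succ, ← Finset.sum_div]
  rw [div_div, pow_succ]

theorem averageFrom_congr {n : ℕ} {a : Fin k × Bool} {f g : List (Fin k × Bool) → ℝ}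
    (h : ∀ w ∈ wordsFrom n a, f w = g w) : averageFrom n a f = averageFrom n a g := by
  rw [averageFrom, averageFrom, Finset.sum_congr rfl h]

theorem averageFrom_add (n : ℕ) (a : Fin k × Bool) (f g : List (Fin k × Bool) → ℝ) :
    averageFrom n a (fun w => f w + g w) = averageFrom n a f + averageFrom n a g := by
  simp [averageFrom, Finset.sum_add_distrib, add_div]

theorem averageFrom_sub (n : ℕ) (a : Fin k × Bool) (f g : List (Fin k × Bool) → ℝ) :
    averageFrom n a (fun w => f w - g w) = averageFrom n a f - averageFrom n a g := by
  simp [averageFrom, Finset.sum_sub_distrib, sub_div]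

theorem averageFrom_mul_left (n : ℕ) (a : Fin k × Bool) (c : ℝ) (f : List (Fin k × Bool) → ℝ) :
    averageFrom n a (fun w => c * f w) = c * averageFrom n a f := by
  simp [averageFrom, ← Finset.mul_sum, mul_div_assoc]

theorem average_add (n : ℕ) (f g : List (Fin k × Bool) → ℝ) :
    average n (fun w => f w + g w) = average n f + average n g := by
  simp [average, averageFrom_add, Finset.sum_add_distrib, add_div]

theorem average_sub (n : ℕ) (f g : List (Fin k × Bool) → ℝ) :
    average n (fun w => f w - g w) = average n f - average n g := by
  simp [average, averageFrom_sub, Finset.sum_sub_distrib, sub_div]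

theorem average_mul_left (n : ℕ) (c : ℝ) (f : List (Fin k × Bool) → ℝ) :
    average n (fun w => c * f w) = c * average n f := by
  simp [average, averageFrom_mul_left, ← Finset.mul_sum, mul_div_assoc]

theorem average_congr {n : ℕ} {f g : List (Fin k × Bool) → ℝ}
    (h : ∀ w, IsReduced w → w.length = n + 1 → f w = g w) : average n f = average n g := by
  rw [average, average]
  congr 1
  refine Finset.sum_congr rfl fun a _ => averageFrom_congr fun w hw => ?_
  rw [mem_wordsFrom] at hw
  exact h w hw.1 hw.2.1

theorem three_le_two_mul_sub_one (hk : 2 ≤ k) : (3 : ℝ) ≤ 2 * k - 1 := by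
  have : (2 : ℝ) ≤ k := by exact_mod_cast hk
  linarith

theorem averageFrom_const (hk : 2 ≤ k) (n : ℕ) (a : Fin k × Bool) (c : ℝ) :
    averageFrom n a (fun _ => c) = c := by
  have h3 := three_le_two_mul_sub_one hk
  induction n generalizing a with
  | zero => rw [averageFrom_zero]
  | succ n ih =>
    rw [averageFrom_succ]
    simp only [ih, Finset.sum_const, nsmul_eq_mul, card_followers]
    field_simp

theorem averageFrom_mono (hk : 2 ≤ k) {n : ℕ} {a : Fin k × Bool} {f g : List (Fin k × Bool) → ℝ}
    (h : ∀ w ∈ wordsFrom n a, f w ≤ g w) : averageFrom n a f ≤ averageFrom n a g := by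
  have h3 := three_le_two_mul_sub_one hk
  exact div_le_div_of_nonneg_right (Finset.sum_le_sum h) (by positivity)

theorem abs_averageFrom_le (hk : 2 ≤ k) {n : ℕ} {a : Fin k × Bool} {f : List (Fin k × Bool) → ℝ}
    {C : ℝ} (h : ∀ w ∈ wordsFrom n a, |f w| ≤ C) : |averageFrom n a f| ≤ C := by
  rw [abs_le]
  constructor
  · rw [← averageFrom_const hk n a (-C)]
    exact averageFrom_mono hk fun w hw => (abs_le.1 (h w hw)).1
  · rw [← averageFrom_const hk n a C]
    exact averageFrom_mono hk fun w hw => (abs_le.1 (h w hw)).2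

theorem average_of_averageFrom_eq (hk : 2 ≤ k) {n : ℕ} {f : List (Fin k × Bool) → ℝ} {c : ℝ}
    (h : ∀ a, averageFrom n a f = c) : average n f = c := by
  have : (2 : ℝ) ≤ k := by exact_mod_cast hk
  rw [average]
  simp [h]
  field_simp

theorem average_const (hk : 2 ≤ k) (n : ℕ) (c : ℝ) :
    average n (fun _ : List (Fin k × Bool) => c) = c :=
  average_of_averageFrom_eq hk fun a => averageFrom_const hk n a c

theorem average_le_average_of_averageFrom_le {m n : ℕ} {f g : List (Fin k × Bool) → ℝ}
    (h : ∀ a, averageFrom m a f ≤ averageFrom n a g) : average m f ≤ average n g :=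
  div_le_div_of_nonneg_right (Finset.sum_le_sum fun a _ => h a) (by positivity)

theorem average_mono (hk : 2 ≤ k) {n : ℕ} {f g : List (Fin k × Bool) → ℝ}
    (h : ∀ w, IsReduced w → w.length = n + 1 → f w ≤ g w) : average n f ≤ average n g := by
  refine average_le_average_of_averageFrom_le fun a => averageFrom_mono hk fun w hw => ?_
  rw [mem_wordsFrom] at hw
  exact h w hw.1 hw.2.1

theorem abs_average_le_of_abs_averageFrom_le (hk : 2 ≤ k) {n : ℕ} {f : List (Fin k × Bool) → ℝ}
    {C : ℝ} (h : ∀ a, |averageFrom n a f| ≤ C) : |average n f| ≤ C := by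
  rw [abs_le]
  constructor
  · rw [← average_const hk n (-C)]
    refine average_le_average_of_averageFrom_le fun a => ?_
    rw [averageFrom_const hk]
    exact (abs_le.1 (h a)).1
  · rw [← average_const hk n C]
    refine average_le_average_of_averageFrom_le fun a => ?_
    rw [averageFrom_const hk]
    exact (abs_le.1 (h a)).2

theorem abs_average_le (hk : 2 ≤ k) {n : ℕ} {f : List (Fin k × Bool) → ℝ}
    {C : ℝ} (h : ∀ w, IsReduced w → w.length = n + 1 → |f w| ≤ C) : |average n f| ≤ C := by
  refine abs_average_le_of_abs_averageFrom_le hk fun a => abs_averageFrom_le hk fun w hw => ?_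
  rw [mem_wordsFrom] at hw
  exact h w hw.1 hw.2.1

/-- The uniform distributions on reduced words are invariant under deleting the first letter. -/
theorem average_tail (hk : 2 ≤ k) (n : ℕ) (f : List (Fin k × Bool) → ℝ) :
    average (n + 1) (fun w => f w.tail) = average n f := by
  have h3 := three_le_two_mul_sub_one hk
  have h2 : (2 : ℝ) ≤ k := by exact_mod_cast hk
  have hinv : ∑ a : Fin k × Bool, averageFrom n (a.1, !a.2) f = ∑ a, averageFrom n a f := by
    refine Fintype.sum_equiv (Equiv.prodCongr (Equiv.refl _) Equiv.boolNot) _ _ fun a => ?_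
    rfl
  -- Every letter follows all letters except its inverse, hence is counted 2k - 1 times.
  have : ∑ a : Fin k × Bool, ∑ b ∈ followers a, averageFrom n b f =
      (2 * k - 1) * ∑ a, averageFrom n a f := by
    simp only [sum_followers, Finset.sum_sub_distrib, hinv]
    simp [mul_comm]
    ring
  simp only [average, averageFrom_succ, List.tail_cons, ← Finset.sum_div]
  rw [this]
  field_simp

/-- All reduced words of a given positive length have equally many reduced extensions, so prefixes
of uniform words are uniform. -/
theorem averageFrom_take (hk : 2 ≤ k) {m n : ℕ} (hmn : m ≤ n) (a : Fin k × Bool)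
    (f : List (Fin k × Bool) → ℝ) :
    averageFrom n a (fun w => f (w.take (m + 1))) = averageFrom m a f := by
  induction m generalizing n a f with
  | zero =>
    rw [averageFrom_zero, averageFrom_congr (g := fun _ => f [a]), averageFrom_const hk]
    intro w hw
    rw [mem_wordsFrom] at hw
    cases w with
    | nil => simp at hw
    | cons b w =>
      obtain rfl : b = a := by simpa using hw.2.2
      rfl
  | succ m ih =>
    obtain ⟨n, rfl⟩ := Nat.exists_eq_add_of_le' (Nat.one_le_of_lt hmn)
    rw [averageFrom_succ, averageFrom_succ]
    congr 1
    refine Finset.sum_congr rfl fun b _ => ?_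
    exact ih (by omega) b fun w => f (a :: w)

theorem average_take (hk : 2 ≤ k) {m n : ℕ} (hmn : m ≤ n) (f : List (Fin k × Bool) → ℝ) :
    average n (fun w => f (w.take (m + 1))) = average m f := by
  simp only [average, averageFrom_take hk hmn]

/-- If `g` depends only on the first `m + 1` letters, and the conditional averages of `f` with
respect to the first `m + 1` letters are bounded, then the average of `f * g` is bounded. -/
theorem abs_averageFrom_mul_le (hk : 2 ≤ k) {G K : ℝ} (hG : 0 ≤ G) {m n : ℕ} (hmn : m ≤ n)
    (a : Fin k × Bool) (f g : List (Fin k × Bool) → ℝ) (hgG : ∀ w, |g w| ≤ G)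
    (hf : ∀ (u : List (Fin k × Bool)) (b : Fin k × Bool), u.length = m →
      |averageFrom (n - m) b (fun w => f (u ++ w))| ≤ K) :
    |averageFrom n a (fun w => g (w.take (m + 1)) * f w)| ≤ G * K := by
  have h3 := three_le_two_mul_sub_one hk
  induction m generalizing n a f g with
  | zero =>
    rw [averageFrom_congr (g := fun w => g [a] * f w), averageFrom_mul_left, abs_mul]
    · exact mul_le_mul (hgG _) (by simpa using hf [] a rfl) (abs_nonneg _) hG
    · intro w hw
      rw [mem_wordsFrom] at hw
      cases w with
      | nil => simp at hw
      | cons b w =>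
        obtain rfl : b = a := by simpa using hw.2.2
        rfl
  | succ m ih =>
    obtain ⟨n, rfl⟩ := Nat.exists_eq_add_of_le' (Nat.one_le_of_lt hmn)
    rw [averageFrom_succ, abs_div, abs_of_nonneg (a := 2 * (k : ℝ) - 1) (by linarith),
      div_le_iff₀ (by linarith)]
    refine (Finset.abs_sum_le_sum_abs _ _).trans ?_
    have : ∀ b ∈ followers a, |averageFrom n b fun w =>
        g ((a :: w).take (m + 1 + 1)) * f (a :: w)| ≤ G * K := by
      intro b _
      refine ih (by omega) b (fun w => f (a :: w)) (fun w => g (a :: w)) (fun w => hgG _) ?_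
      intro u b hu
      have := hf (a :: u) b (by simp [hu])
      rwa [Nat.add_sub_add_right] at this
    refine (Finset.sum_le_sum this).trans ?_
    rw [Finset.sum_const, nsmul_eq_mul, card_followers, mul_comm]

end Averages

end FreeGroup

/-! ### Linear growth of the mean and of the variance -/

namespace FreeGroup

section Variance

variable {k : ℕ} {N : List (Fin k × Bool) → ℝ} {D : ℝ}

theorem abs_append_sub_le (hN : ∀ a w, |N (a :: w) - N w| ≤ D) (u w : List (Fin k × Bool)) :
    |N (u ++ w) - N w| ≤ u.length * D := by
  induction u with
  | nil => simp
  | cons a u ih =>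
    have := abs_sub_le (N (a :: (u ++ w))) (N (u ++ w)) (N w)
    have := hN a (u ++ w)
    simp only [List.cons_append, List.length_cons]
    push_cast
    linarith

theorem abs_sub_tail_le (hD : 0 ≤ D) (hN : ∀ a w, |N (a :: w) - N w| ≤ D)
    (w : List (Fin k × Bool)) : |N w - N w.tail| ≤ D := by
  cases w with
  | nil => simpa using hD
  | cons a w => exact hN a w

theorem average_succ_sub_average (hk : 2 ≤ k) (n : ℕ) (N : List (Fin k × Bool) → ℝ) :
    average (n + 1) N - average n N = average (n + 1) fun w => N w - N w.tail := by
  rw [average_sub, average_tail hk]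

theorem abs_average_succ_sub_le (hk : 2 ≤ k) (hD : 0 ≤ D) (hN : ∀ a w, |N (a :: w) - N w| ≤ D)
    (n : ℕ) : |average (n + 1) N - average n N| ≤ D := by
  rw [average_succ_sub_average hk]
  exact abs_average_le hk fun w _ _ => abs_sub_tail_le hD hN w

theorem abs_average_add_sub_le (hk : 2 ≤ k) (hD : 0 ≤ D) (hN : ∀ a w, |N (a :: w) - N w| ≤ D)
    (n j : ℕ) : |average (n + j) N - average n N| ≤ j * D := by
  induction j with
  | zero => simp
  | succ j ih =>
    have := abs_average_succ_sub_le hk hD hN (n + j)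
    have := abs_sub_le (average (n + (j + 1)) N) (average (n + j) N) (average n N)
    push_cast
    rw [← add_assoc] at *
    linarith

/-- Conditioning on the first letter changes the average of a Lipschitz function only by a bounded
amount. -/
theorem abs_averageFrom_sub_average_le (hk : 2 ≤ k) (hD : 0 ≤ D)
    (hN : ∀ a w, |N (a :: w) - N w| ≤ D) (n : ℕ) (a : Fin k × Bool) :
    |averageFrom n a N - average n N| ≤ 3 * D := by
  have h3 := three_le_two_mul_sub_one hk
  have h2 : (2 : ℝ) ≤ k := by exact_mod_cast hk
  induction n generalizing a with
  | zero =>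
    have h1 : |average 0 N - N []| ≤ D := by
      have := average_const hk 0 (N [])
      rw [← this, ← average_sub]
      refine abs_average_le hk fun w _ hw => ?_
      obtain ⟨b, rfl⟩ := List.length_eq_one_iff.1 hw
      simpa using hN b []
    rw [averageFrom_zero]
    have := hN a []
    have := abs_sub_le (N [a]) (N []) (average 0 N)
    rw [abs_sub_comm] at h1
    linarith
  | succ n ih =>
    -- Averaging over all letters except a⁻¹ leaves only the deviation at a⁻¹, divided by 2k - 1 ≥
    -- 3. The bound 3D reproduces itself: D for dropping the letter, D for the shift of the mean,
    -- and 3D/3 from the induction hypothesis.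
    have e1 : averageFrom (n + 1) a (fun w => N w.tail) =
        average n N - (averageFrom n (a.1, !a.2) N - average n N) / (2 * k - 1) := by
      rw [averageFrom_succ]
      simp only [List.tail_cons]
      rw [sum_followers]
      have : ∑ b, averageFrom n b N = 2 * k * average n N := by
        rw [average]; field_simp
      rw [this]
      field_simp
      ring
    have e2 : |averageFrom (n + 1) a N - averageFrom (n + 1) a (fun w => N w.tail)| ≤ D := by
      rw [← averageFrom_sub]
      exact abs_averageFrom_le hk fun w _ => abs_sub_tail_le hD hN w
    have e3 := abs_average_succ_sub_le hk hD hN n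
    have e4 : |(averageFrom n (a.1, !a.2) N - average n N) / (2 * k - 1)| ≤ D := by
      rw [abs_div, abs_of_nonneg (a := 2 * (k : ℝ) - 1) (by linarith), div_le_iff₀ (by linarith)]
      have := ih (a.1, !a.2)
      nlinarith
    rw [abs_le] at *
    constructor <;> linarith [e2.1, e2.2, e3.1, e3.2, e4.1, e4.2]

/-- The eventual increment of the averages. -/
noncomputable def averageIncrement (m : ℕ) (N : List (Fin k × Bool) → ℝ) : ℝ :=
  average m fun w => N w - N w.tail

/-- The increment of the means is the mean of the increment, by invariance under deleting the first
letter; as a function of a prefix of length m + 1, the increment has a mean that no longer depends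
on n. -/
theorem average_succ_eq (hk : 2 ≤ k) {m : ℕ}
    (hstab : ∀ w, IsReduced w → m + 1 ≤ w.length →
      N w - N w.tail = N (w.take (m + 1)) - N (w.take (m + 1)).tail)
    {n : ℕ} (hn : m ≤ n + 1) : average (n + 1) N = average n N + averageIncrement m N := by
  rw [← sub_eq_iff_eq_add', average_succ_sub_average hk, averageIncrement,
    ← average_take hk hn]
  exact average_congr fun w hw hlen => hstab w hw (by omega)

/-- Split N into its value on the tail and the increment. The increment depends on a bounded prefix,
which hardly influences the mean of the tail, so the covariance of the two is bounded independently
of n. -/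
theorem average_sq_succ_le (hk : 2 ≤ k) (hD : 0 ≤ D) (hN : ∀ a w, |N (a :: w) - N w| ≤ D) {m : ℕ}
    (hstab : ∀ w, IsReduced w → m + 1 ≤ w.length →
      N w - N w.tail = N (w.take (m + 1)) - N (w.take (m + 1)).tail)
    {n : ℕ} (hn : m ≤ n) :
    average (n + 1) (fun w => (N w - average (n + 1) N) ^ 2) ≤
      average n (fun w => (N w - average n N) ^ 2) +
        (4 * D * ((2 * m + 5) * D) + 4 * D ^ 2) := by
  set δ := average (n + 1) N - average n N with hδ
  have hδD : |δ| ≤ D := abs_average_succ_sub_le hk hD hN n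
  -- The centred increment. Evaluated at the prefix of length m + 1 it has the same value as at the
  -- whole word.
  let ζ : List (Fin k × Bool) → ℝ := fun w => N w - N w.tail - δ
  have hζ : ∀ w, |ζ w| ≤ 2 * D := by
    intro w
    have h1 := abs_sub_tail_le hD hN w
    have h2 := abs_sub (N w - N w.tail) δ
    linarith
  have e1 : average (n + 1) (fun w => (N w - average (n + 1) N) ^ 2) =
      average n (fun w => (N w - average n N) ^ 2) +
      2 * average (n + 1) (fun w => ζ (w.take (m + 1)) * (N w.tail - average n N)) +
      average (n + 1) (fun w => ζ (w.take (m + 1)) ^ 2) := by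
    rw [← average_tail hk n, ← average_mul_left, ← average_add, ← average_add]
    refine average_congr fun w hw hlen => ?_
    have : ζ (w.take (m + 1)) = N w - N w.tail - δ := by
      rw [hstab w hw (by omega)]
    rw [this, hδ]
    ring
  have e2 : average (n + 1) (fun w => ζ (w.take (m + 1)) ^ 2) ≤ 4 * D ^ 2 := by
    refine (average_mono hk (g := fun _ => 4 * D ^ 2) fun w _ _ => ?_).trans_eq
      (average_const hk _ _)
    rw [← sq_abs]
    have := hζ (w.take (m + 1))
    have := abs_nonneg (ζ (w.take (m + 1)))
    nlinarith
  -- The factor 2m + 5 collects m + 1 for removing the fixed prefix u, 3 for conditioning on the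
  -- next letter, and m + 1 for comparing means at different lengths.
  have e3 : |average (n + 1) (fun w => ζ (w.take (m + 1)) * (N w.tail - average n N))| ≤
      2 * D * ((2 * m + 5) * D) := by
    refine abs_average_le_of_abs_averageFrom_le hk fun a => ?_
    refine abs_averageFrom_mul_le hk (by positivity) (by omega) a
      (fun w => N w.tail - average n N) ζ hζ fun u b hu => ?_
    obtain ⟨j, rfl⟩ := Nat.exists_eq_add_of_le hn
    have hj : m + j + 1 - m = j + 1 := by omega
    rw [hj]
    have h1 := abs_averageFrom_sub_average_le hk hD hN (j + 1) b
    have h2 : |averageFrom (j + 1) b (fun w => N (u ++ w).tail - N w)| ≤ (m + 1) * D := by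
      refine abs_averageFrom_le hk fun w _ => ?_
      have h3 := abs_sub_tail_le hD hN (u ++ w)
      have h4 := abs_append_sub_le hN u w
      rw [abs_sub_comm] at h3
      have h5 := abs_sub_le (N (u ++ w).tail) (N (u ++ w)) (N w)
      rw [hu] at h4
      linarith
    have h3 : |average (m + j) N - average (j + 1) N| ≤ (m + 1) * D := by
      have h4 := abs_average_succ_sub_le hk hD hN j
      have h5 := abs_average_add_sub_le hk hD hN j m
      have h6 := abs_sub_le (average (j + m) N) (average j N) (average (j + 1) N)
      rw [abs_sub_comm] at h4
      rw [add_comm m j]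
      linarith
    have h4 : averageFrom (j + 1) b (fun w => N (u ++ w).tail - average (m + j) N) =
        averageFrom (j + 1) b (fun w => N (u ++ w).tail - N w) +
        (averageFrom (j + 1) b N - average (j + 1) N) -
        (average (m + j) N - average (j + 1) N) := by
      rw [averageFrom_sub, averageFrom_sub, averageFrom_const hk]
      ring
    rw [h4]
    rw [abs_le] at *
    constructor <;> linarith [h1.1, h1.2, h2.1, h2.2, h3.1, h3.2]
  have e4 := (abs_le.1 e3).2
  rw [e1]
  linarith

theorem average_eq_add_mul (hk : 2 ≤ k) {m : ℕ}
    (hstab : ∀ w, IsReduced w → m + 1 ≤ w.length →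
      N w - N w.tail = N (w.take (m + 1)) - N (w.take (m + 1)).tail) (j : ℕ) :
    average (m + j) N = average m N + j * averageIncrement m N := by
  induction j with
  | zero => simp
  | succ j ih =>
    rw [← add_assoc, average_succ_eq hk hstab (by omega), ih]
    push_cast
    ring

theorem exists_average_sq_le (hk : 2 ≤ k) (hD : 0 ≤ D) (hN : ∀ a w, |N (a :: w) - N w| ≤ D) {m : ℕ}
    (hstab : ∀ w, IsReduced w → m + 1 ≤ w.length →
      N w - N w.tail = N (w.take (m + 1)) - N (w.take (m + 1)).tail) :
    ∃ C, 0 ≤ C ∧ ∀ n, m ≤ n →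
      average n (fun w => (N w - (n + 1 : ℕ) * averageIncrement m N) ^ 2) ≤ C * (n + 1 : ℕ) := by
  set lam := averageIncrement m N
  set c := 4 * D * ((2 * m + 5) * D) + 4 * D ^ 2
  have hc : 0 ≤ c := by positivity
  set v := average m fun w => (N w - average m N) ^ 2
  have hv : 0 ≤ v :=
    (average_const hk m 0).symm.trans_le (average_mono hk fun w _ _ => by positivity)
  have hV : ∀ j : ℕ, average (m + j) (fun w => (N w - average (m + j) N) ^ 2) ≤ v + j * c := by
    intro j
    induction j with
    | zero => simp [v]
    | succ j ih =>
      have := average_sq_succ_le hk hD hN hstab (n := m + j) (by omega)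
      rw [← add_assoc]
      push_cast
      linarith
  -- The squared bias. It is the same for every n ≥ m, because the mean at word length n + 1 grows
  -- by exactly `lam` per letter.
  set B := (average m N - (m + 1) * lam) ^ 2
  refine ⟨2 * v + 2 * c + 2 * B, by positivity, fun n hn => ?_⟩
  obtain ⟨j, rfl⟩ := Nat.exists_eq_add_of_le hn
  have h1 : average (m + j) N - (m + j + 1 : ℕ) * lam = average m N - (m + 1) * lam := by
    rw [average_eq_add_mul hk hstab]
    push_cast
    ring
  have h2 : average (m + j) (fun w => (N w - (m + j + 1 : ℕ) * lam) ^ 2) ≤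
      2 * average (m + j) (fun w => (N w - average (m + j) N) ^ 2) + 2 * B := by
    rw [← average_mul_left, ← average_const hk (m + j) (2 * B), ← average_add]
    refine average_mono hk fun w _ _ => ?_
    simp only [B, ← h1]
    nlinarith [sq_nonneg (N w - average (m + j) N - (average (m + j) N - (m + j + 1 : ℕ) * lam))]
  have h3 := hV j
  have h4 : (0 : ℝ) ≤ m := m.cast_nonneg
  have h5 : (0 : ℝ) ≤ j := j.cast_nonneg
  have h6 : 0 ≤ B := by positivity
  refine h2.trans ?_
  push_cast
  nlinarith [mul_nonneg h4 hv, mul_nonneg h5 hv, mul_nonneg h4 hc, mul_nonneg h5 hc,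
    mul_nonneg h4 h6, mul_nonneg h5 h6]

end Variance

end FreeGroup

/-! ### From averages over words to almost sure convergence -/

namespace FreeBoundary

open FreeGroup

variable {k : ℕ}

theorem isReduced_initialWord (ω : FreeBoundary k) (n : ℕ) : IsReduced (ω.initialWord n) := by
  rw [← toWord_vertex]
  exact isReduced_toWord

theorem length_initialWord (ω : FreeBoundary k) (n : ℕ) : (ω.initialWord n).length = n := by
  simp [initialWord]

theorem initialWord_succ (ω : FreeBoundary k) (n : ℕ) :
    ω.initialWord (n + 1) = ω.initialWord n ++ [ω.1 n] := by
  simp [initialWord, List.range_succ]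

theorem measurableSet_initialWord_eq {w : List (Fin k × Bool)} (hw : IsReduced w) :
    MeasurableSet {ω : FreeBoundary k | ω.initialWord w.length = w} := by
  have : {ω : FreeBoundary k | ω.initialWord w.length = w} = cyl (mk w) := by
    ext ω
    rw [mem_cyl_iff, toWord_mk, hw.reduce_eq, Set.mem_ofPred_eq]
  rw [this]
  exact MeasurableSpace.measurableSet_generateFrom ⟨_, rfl⟩

theorem measureReal_initialWord_eq (hk : 2 ≤ k) {n : ℕ} {w : List (Fin k × Bool)}
    (hw : IsReduced w) (hlen : w.length = n + 1) :
    (uniformMeasure hk).real {ω : FreeBoundary k | ω.initialWord (n + 1) = w} =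
      1 / (2 * k * (2 * k - 1) ^ n) := by
  have h1 : {ω : FreeBoundary k | ω.initialWord (n + 1) = w} = cyl (mk w) := by
    ext ω
    rw [mem_cyl_iff, toWord_mk, hw.reduce_eq, Set.mem_ofPred_eq, hlen]
  have h2 : (mk w).norm = n + 1 := by
    rw [FreeGroup.norm, toWord_mk, hw.reduce_eq, hlen]
  rw [h1, (isUniform_uniformMeasure hk).real_cyl, h2, Nat.add_sub_cancel]
  intro h
  rw [h, FreeGroup.norm_one] at h2
  omega

/-- A function of the first n + 1 letters is a finite combination of indicators of cylinders;
measurability, integrability and the integral are all read off from this. -/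
theorem apply_initialWord_eq_sum (n : ℕ) (f : List (Fin k × Bool) → ℝ) (ω : FreeBoundary k) :
    f (ω.initialWord (n + 1)) = ∑ a, ∑ w ∈ wordsFrom n a,
      {ω : FreeBoundary k | ω.initialWord (n + 1) = w}.indicator (fun _ => f w) ω := by
  have hmem : ω.initialWord (n + 1) ∈ wordsFrom n (ω.1 0) := by
    rw [mem_wordsFrom]
    exact ⟨isReduced_initialWord ω _, length_initialWord ω _, by simp [initialWord, List.range_succ_eq_map]⟩
  rw [Finset.sum_eq_single (ω.1 0), Finset.sum_eq_single (ω.initialWord (n + 1))]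
  · simp
  · intro w _ hw
    exact Set.indicator_of_notMem (fun h => hw h.symm) _
  · intro h
    exact absurd hmem h
  · intro a _ ha
    refine Finset.sum_eq_zero fun w hw => Set.indicator_of_notMem (fun h => ha ?_) _
    rw [Set.mem_ofPred_eq] at h
    subst h
    rw [mem_wordsFrom] at hw hmem
    exact Option.some.inj (hw.2.2.symm.trans hmem.2.2)
  · simp

theorem measurable_apply_initialWord (n : ℕ) (f : List (Fin k × Bool) → ℝ) :
    Measurable fun ω : FreeBoundary k => f (ω.initialWord n) := by
  cases n with
  | zero => simp [initialWord]
  | succ n =>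
    simp only [apply_initialWord_eq_sum]
    refine Finset.measurable_sum _ fun a _ => Finset.measurable_sum _ fun w hw => ?_
    rw [mem_wordsFrom] at hw
    refine measurable_const.indicator ?_
    rw [← hw.2.1]
    exact measurableSet_initialWord_eq hw.1

theorem integrable_indicator_initialWord (hk : 2 ≤ k) {n : ℕ} {a : Fin k × Bool}
    {w : List (Fin k × Bool)} (hw : w ∈ wordsFrom n a) (c : ℝ) :
    Integrable ({ω : FreeBoundary k | ω.initialWord (n + 1) = w}.indicator fun _ => c)
      (uniformMeasure hk) := by
  have := (isUniform_uniformMeasure hk).isProbabilityMeasure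
  rw [mem_wordsFrom] at hw
  refine (integrable_const c).indicator ?_
  rw [← hw.2.1]
  exact measurableSet_initialWord_eq hw.1

theorem integrable_apply_initialWord (hk : 2 ≤ k) (n : ℕ) (f : List (Fin k × Bool) → ℝ) :
    Integrable (fun ω : FreeBoundary k => f (ω.initialWord (n + 1))) (uniformMeasure hk) := by
  simp only [apply_initialWord_eq_sum]
  exact integrable_finsetSum _ fun a _ => integrable_finsetSum _ fun w hw =>
    integrable_indicator_initialWord hk hw _

theorem integral_apply_initialWord (hk : 2 ≤ k) (n : ℕ) (f : List (Fin k × Bool) → ℝ) :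
    ∫ ω : FreeBoundary k, f (ω.initialWord (n + 1)) ∂(uniformMeasure hk) = average n f := by
  simp only [apply_initialWord_eq_sum]
  rw [integral_finsetSum _ fun a _ => integrable_finsetSum _ fun w hw =>
    integrable_indicator_initialWord hk hw _]
  simp only [FreeGroup.average, averageFrom, Finset.sum_div]
  refine Finset.sum_congr rfl fun a _ => ?_
  rw [integral_finsetSum _ fun w hw => integrable_indicator_initialWord hk hw _]
  refine Finset.sum_congr rfl fun w hw => ?_
  rw [mem_wordsFrom] at hw
  rw [integral_indicator_const _ (by rw [← hw.2.1]; exact measurableSet_initialWord_eq hw.1),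
    measureReal_initialWord_eq hk hw.1 hw.2.1, smul_eq_mul, div_div, one_div, mul_comm, mul_comm (2 * (k : ℝ))]
  rfl

/-- At length r² the quotient N/r² has mean square distance at most C/r² from `lam`. This is
summable, so the sum of the squared deviations is almost surely finite and its terms tend to zero.
-/
theorem ae_tendsto_initialWord_sq (hk : 2 ≤ k) {N : List (Fin k × Bool) → ℝ} {lam C : ℝ} {m : ℕ}
    (hC : 0 ≤ C)
    (h : ∀ n, m ≤ n → average n (fun w => (N w - (n + 1 : ℕ) * lam) ^ 2) ≤ C * (n + 1 : ℕ)) :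
    ∀ᵐ ω : FreeBoundary k ∂(uniformMeasure hk),
      Tendsto (fun j : ℕ => N (ω.initialWord (j ^ 2)) / (j ^ 2 : ℕ)) atTop (𝓝 lam) := by
  -- The shift ensures r² ≥ m + 1, so that the second moment bound applies to every term and no
  -- denominator vanishes.
  let r : ℕ → ℕ := fun j => j + m + 1
  let F : ℕ → FreeBoundary k → ENNReal := fun j ω =>
    ENNReal.ofReal ((N (ω.initialWord (r j ^ 2)) / (r j ^ 2 : ℕ) - lam) ^ 2)
  have hmeas : ∀ j, Measurable (F j) := fun j =>
    (measurable_apply_initialWord (r j ^ 2) fun w =>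
      (N w / (r j ^ 2 : ℕ) - lam) ^ 2).ennreal_ofReal
  have hF : ∀ j, ∫⁻ ω, F j ω ∂(uniformMeasure hk) ≤ ENNReal.ofReal (C * (1 / (r j : ℝ) ^ 2)) := by
    intro j
    obtain ⟨n, hn⟩ : ∃ n, r j ^ 2 = n + 1 := ⟨r j ^ 2 - 1, by
      have : 0 < r j ^ 2 := by positivity
      omega⟩
    have hmn : m ≤ n := by
      have : r j ≤ r j ^ 2 := Nat.le_self_pow (by norm_num) _
      simp only [r] at *
      omega
    have hpos : (0 : ℝ) < (n + 1 : ℕ) := by positivity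
    have hcast : (r j : ℝ) ^ 2 = (n + 1 : ℕ) := by rw [← hn]; push_cast; rfl
    simp only [F, hn]
    rw [← ofReal_integral_eq_lintegral_ofReal
      (integrable_apply_initialWord hk n fun w => (N w / (n + 1 : ℕ) - lam) ^ 2)
      (ae_of_all _ fun ω => sq_nonneg _)]
    refine ENNReal.ofReal_le_ofReal ?_
    rw [integral_apply_initialWord hk n fun w => (N w / (n + 1 : ℕ) - lam) ^ 2, hcast]
    have e : (fun w => (N w / (n + 1 : ℕ) - lam) ^ 2) = fun w =>
        (1 / ((n + 1 : ℕ) : ℝ) ^ 2) * (N w - (n + 1 : ℕ) * lam) ^ 2 := by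
      funext w
      field_simp
    rw [e, average_mul_left]
    refine (mul_le_mul_of_nonneg_left (h n hmn) (by positivity)).trans_eq ?_
    field_simp
  have hsum : ∑' j, ∫⁻ ω, F j ω ∂(uniformMeasure hk) ≠ ⊤ := by
    refine ne_top_of_le_ne_top ?_ (ENNReal.tsum_le_tsum hF)
    have hs : Summable fun j : ℕ => C * (1 / (r j : ℝ) ^ 2) := by
      refine Summable.mul_left _ ?_
      have := (summable_nat_add_iff (m + 1)).2
        (Real.summable_one_div_nat_pow (p := 2).2 (by norm_num))
      simpa [r, add_assoc] using this
    rw [← ENNReal.ofReal_tsum_of_nonneg (fun j => by positivity) hs]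
    exact ENNReal.ofReal_ne_top
  rw [← lintegral_tsum fun j => (hmeas j).aemeasurable] at hsum
  filter_upwards [ae_lt_top (Measurable.tsum hmeas) hsum] with ω hω
  have h1 := ENNReal.tendsto_atTop_zero_of_tsum_ne_top hω.ne
  have h2 := (ENNReal.tendsto_toReal ENNReal.zero_ne_top).comp h1
  have h3 : Tendsto (fun j => (N (ω.initialWord (r j ^ 2)) / (r j ^ 2 : ℕ) - lam) ^ 2)
      atTop (𝓝 0) := by
    refine h2.congr fun j => ?_
    exact ENNReal.toReal_ofReal (sq_nonneg _)
  have h4 : Tendsto (fun j => |N (ω.initialWord (r j ^ 2)) / (r j ^ 2 : ℕ) - lam|)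
      atTop (𝓝 0) := by
    have := (Real.continuous_sqrt.tendsto 0).comp h3
    simpa [Function.comp_def, Real.sqrt_sq_eq_abs] using this
  have h5 := tendsto_sub_nhds_zero_iff.1 ((tendsto_zero_iff_abs_tendsto_zero _).2 h4)
  exact (tendsto_add_atTop_iff_nat
    (f := fun j : ℕ => N (ω.initialWord (j ^ 2)) / (j ^ 2 : ℕ)) (m + 1)).1 h5

/-- For n = j² + i between consecutive squares, i ≤ 2j, so x differs from its value at j² by O(j),
which is negligible against j². -/
theorem tendsto_div_of_tendsto_sq {x : ℕ → ℝ} {lam D : ℝ} (hx : ∀ n, |x (n + 1) - x n| ≤ D)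
    (h : Tendsto (fun j : ℕ => x (j ^ 2) / (j ^ 2 : ℕ)) atTop (𝓝 lam)) :
    Tendsto (fun n : ℕ => x n / n) atTop (𝓝 lam) := by
  have hD : 0 ≤ D := (abs_nonneg _).trans (hx 0)
  have hadd : ∀ n j : ℕ, |x (n + j) - x n| ≤ j * D := by
    intro n j
    induction j with
    | zero => simp
    | succ j ih =>
      have h1 := hx (n + j)
      have := abs_sub_le (x (n + (j + 1))) (x (n + j)) (x n)
      rw [← add_assoc] at *
      push_cast
      linarith
  have hsqrt : Tendsto Nat.sqrt atTop atTop :=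
    tendsto_atTop_atTop.2 fun b => ⟨b ^ 2, fun n hn => Nat.le_sqrt'.2 hn⟩
  have h1 : Tendsto (fun j : ℕ => |x (j ^ 2) / (j ^ 2 : ℕ) - lam| + 2 * (D + |lam|) / j)
      atTop (𝓝 0) := by
    have := (tendsto_sub_nhds_zero_iff.2 h).abs.add
      (tendsto_const_div_atTop_nhds_zero_nat (2 * (D + |lam|)))
    simpa using this
  rw [← tendsto_sub_nhds_zero_iff, tendsto_zero_iff_abs_tendsto_zero]
  refine squeeze_zero' (Eventually.of_forall fun n => abs_nonneg _) ?_ (h1.comp hsqrt)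
  filter_upwards [eventually_ge_atTop 1] with n hn
  set j := n.sqrt with hj
  have hj0 : 0 < j := Nat.sqrt_pos.2 hn
  obtain ⟨i, hi⟩ := Nat.exists_eq_add_of_le (Nat.sqrt_le' n)
  rw [← hj] at hi
  have hi2 : i ≤ 2 * j := by
    have h2 := Nat.sqrt_le_add n
    rw [← hj] at h2
    nlinarith
  have hjR : (0 : ℝ) < j := by exact_mod_cast hj0
  have hnR : (n : ℝ) = (j : ℝ) ^ 2 + i := by rw [hi]; push_cast; rfl
  have hiR : (i : ℝ) ≤ 2 * j := by exact_mod_cast hi2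
  have hi0 : (0 : ℝ) ≤ i := i.cast_nonneg
  have hn0 : (0 : ℝ) < n := by exact_mod_cast hn
  have e1 := hadd (j ^ 2) i
  rw [← hi] at e1
  have e2 : |x n - n * lam| ≤ |x (j ^ 2) - (j : ℝ) ^ 2 * lam| + i * (D + |lam|) := by
    have : x n - n * lam = (x n - x (j ^ 2)) + (x (j ^ 2) - (j : ℝ) ^ 2 * lam) - i * lam := by
      rw [hnR]; ring
    rw [this]
    have h3 := abs_sub (x n - x (j ^ 2) + (x (j ^ 2) - (j : ℝ) ^ 2 * lam)) (i * lam)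
    have h4 := abs_add_le (x n - x (j ^ 2)) (x (j ^ 2) - (j : ℝ) ^ 2 * lam)
    rw [abs_mul, abs_of_nonneg hi0] at h3
    linarith
  have e3 : x n / n - lam = (x n - n * lam) / n := by field_simp
  have e4 : x (j ^ 2) / (j ^ 2 : ℕ) - lam = (x (j ^ 2) - (j : ℝ) ^ 2 * lam) / (j : ℝ) ^ 2 := by
    push_cast
    field_simp
  simp only [Function.comp_apply]
  rw [e3, e4, abs_div, abs_div, abs_of_pos hn0, abs_of_pos (pow_pos hjR 2)]
  calc |x n - n * lam| / n ≤ |x n - n * lam| / (j : ℝ) ^ 2 := by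
        refine div_le_div_of_nonneg_left (abs_nonneg _) (by positivity) ?_
        rw [hnR]; linarith
    _ ≤ (|x (j ^ 2) - (j : ℝ) ^ 2 * lam| + 2 * j * (D + |lam|)) / (j : ℝ) ^ 2 := by
        refine div_le_div_of_nonneg_right (e2.trans ?_) (by positivity)
        have : i * (D + |lam|) ≤ 2 * j * (D + |lam|) :=
          mul_le_mul_of_nonneg_right hiR (by positivity)
        linarith
    _ = _ := by
        rw [← hj]
        field_simp

end FreeBoundary

/-! ### Convergence in mean and the stretching factor of a homomorphism -/

section Convergence

open FreeBoundary

variable {k : ℕ}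

/-- Almost sure convergence of a function which is Lipschitz along rays implies the convergence in
mean. -/
theorem isGenericStretchingFactor_of_ae (hk : 2 ≤ k) {N : FreeGroup (Fin k) → ℝ} {lam D : ℝ}
    (hN : ∀ (ω : FreeBoundary k) (n : ℕ), |N (ω.vertex n)| ≤ n * D)
    (h : ∀ᵐ ω ∂(uniformMeasure hk), Tendsto (fun n : ℕ => N (ω.vertex n) / n) atTop (𝓝 lam)) :
    IsGenericStretchingFactor hk N lam := by
  have := (isUniform_uniformMeasure hk).isProbabilityMeasure
  refine ⟨h, ?_⟩
  have hbound : ∀ (n : ℕ) (ω : FreeBoundary k), |N (ω.vertex n) / n - lam| ≤ |D| + |lam| := by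
    intro n ω
    refine (abs_sub _ _).trans (add_le_add ?_ le_rfl)
    rw [abs_div, Nat.abs_cast]
    rcases n.eq_zero_or_pos with rfl | hn
    · simp
    · have hnR : (0 : ℝ) < n := by exact_mod_cast hn
      rw [div_le_iff₀ hnR]
      have := hN ω n
      nlinarith [le_abs_self D]
  simp only [eLpNorm_one_eq_lintegral_enorm]
  have h1 := tendsto_lintegral_of_dominated_convergence (μ := uniformMeasure hk)
    (F := fun (n : ℕ) ω => ‖N (ω.vertex n) / n - lam‖ₑ) (f := fun _ => 0)
    (fun _ => ENNReal.ofReal (|D| + |lam|))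
    (fun n => (measurable_apply_initialWord n fun w => N (FreeGroup.mk w) / n - lam).enorm)
    (fun n => ae_of_all _ fun ω => by
      change ‖N (ω.vertex n) / n - lam‖ₑ ≤ _
      rw [← ofReal_norm]
      exact ENNReal.ofReal_le_ofReal (hbound n ω))
    (by simp)
    (by
      filter_upwards [h] with ω hω
      have := (tendsto_sub_nhds_zero_iff.2 hω).enorm
      simpa using this)
  simpa using h1

/-- Stretching factors do not change under bounded perturbations. -/
theorem IsGenericStretchingFactor.of_bounded_sub {hk : 2 ≤ k} {N N' : FreeGroup (Fin k) → ℝ}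
    {lam D C : ℝ} (h : IsGenericStretchingFactor hk N lam)
    (hN' : ∀ (ω : FreeBoundary k) (n : ℕ), |N' (ω.vertex n)| ≤ n * D)
    (hC : ∀ g, |N' g - N g| ≤ C) : IsGenericStretchingFactor hk N' lam := by
  refine isGenericStretchingFactor_of_ae hk hN' ?_
  filter_upwards [h.1] with ω hω
  have h1 : Tendsto (fun n : ℕ => N' (ω.vertex n) / n - N (ω.vertex n) / n) atTop (𝓝 0) := by
    refine squeeze_zero_norm (fun n => ?_) (tendsto_const_div_atTop_nhds_zero_nat C)
    rw [← sub_div, norm_div, Real.norm_eq_abs, Real.norm_eq_abs, Nat.abs_cast]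
    exact div_le_div_of_nonneg_right (hC _) (by positivity)
  simpa using h1.add hω

/-- The generic stretching factor of the semi-norm `|c(·)|` which is induced by a homomorphism of
free groups, provided that large elements have large images. -/
theorem isGenericStretchingFactor_norm_map (hk : 2 ≤ k) {E : Type*} [DecidableEq E]
    (c : FreeGroup (Fin k) →* FreeGroup E) {D m : ℕ} (hD : ∀ i, (c (.of i)).norm ≤ D)
    (hm : ∀ g : FreeGroup (Fin k), m ≤ g.norm → D < (c g).norm) :
    IsGenericStretchingFactor hk (fun g => (c g).norm)
      (FreeGroup.averageIncrement m fun w => ((c (.mk w)).norm : ℝ)) := by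
  have hlip : ∀ g h : FreeGroup (Fin k), |((c (g * h)).norm : ℝ) - (c h).norm| ≤ (c g).norm := by
    intro g h
    have h1 := FreeGroup.norm_mul_le (c g) (c h)
    have h2 := FreeGroup.norm_mul_le (c g)⁻¹ (c g * c h)
    rw [inv_mul_cancel_left, FreeGroup.norm_inv_eq] at h2
    rw [_root_.map_mul, abs_le]
    have h3 : ((c g * c h).norm : ℝ) ≤ (c g).norm + (c h).norm := by exact_mod_cast h1
    have h4 : ((c h).norm : ℝ) ≤ (c g).norm + (c g * c h).norm := by exact_mod_cast h2
    constructor <;> linarith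
  have hletter : ∀ a, ((c (.mk [a])).norm : ℝ) ≤ D := by
    intro a
    have := FreeGroup.norm_map_mk_le c hD [a]
    simp only [List.length_singleton, mul_one] at this
    exact_mod_cast this
  have hleft : ∀ a w, |((c (.mk (a :: w))).norm : ℝ) - (c (.mk w)).norm| ≤ D := by
    intro a w
    rw [← List.singleton_append, ← FreeGroup.mul_mk]
    exact (hlip _ _).trans (hletter a)
  obtain ⟨C, hC, hsq⟩ := FreeGroup.exists_average_sq_le hk (Nat.cast_nonneg D) hleft
    fun w hw hlen => FreeGroup.norm_increment_eq c hD hm hw hlen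
  refine isGenericStretchingFactor_of_ae hk (D := D) (fun ω n => ?_) ?_
  · have := FreeGroup.norm_map_mk_le c hD (ω.initialWord n)
    rw [length_initialWord] at this
    rw [Nat.abs_cast, mul_comm]
    exact_mod_cast this
  · filter_upwards [ae_tendsto_initialWord_sq hk hC hsq] with ω hω
    refine tendsto_div_of_tendsto_sq (x := fun n => ((c (ω.vertex n)).norm : ℝ)) (D := D) ?_ hω
    intro n
    rw [vertex, vertex, initialWord_succ, ← FreeGroup.mul_mk]
    -- Along a ray letters are appended on the right; inverting turns this into multiplication on
    -- the left, for which the Lipschitz bound is stated.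
    have h1 := hlip (FreeGroup.mk [ω.1 n])⁻¹ (FreeGroup.mk (ω.initialWord n))⁻¹
    rw [← mul_inv_rev, _root_.map_inv, _root_.map_inv, _root_.map_inv, FreeGroup.norm_inv_eq, FreeGroup.norm_inv_eq,
      FreeGroup.norm_inv_eq] at h1
    exact h1.trans (hletter _)

end Convergence

/-! ### Schreier generators of the image -/

namespace FreeGroup

section Schreier

variable {E : Type*} (H : Subgroup (FreeGroup E))

theorem exists_word_of_coset (q : FreeGroup E ⧸ H) :
    {w : List (E × Bool) | ((mk w : FreeGroup E) : FreeGroup E ⧸ H) = q}.Nonempty := by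
  classical
  obtain ⟨g, rfl⟩ := QuotientGroup.mk_surjective q
  exact ⟨g.toWord, by rw [Set.mem_ofPred_eq, mk_toWord]⟩

theorem wellFounded_shortlex :
    WellFounded (List.Shortlex (WellOrderingRel (α := E × Bool))) :=
  List.Shortlex.wf WellOrderingRel.isWellOrder.wf

/-- The shortlex-minimal word which represents a coset. -/
noncomputable def minWord (q : FreeGroup E ⧸ H) : List (E × Bool) :=
  wellFounded_shortlex.min _ (exists_word_of_coset H q)

theorem mk_minWord (q : FreeGroup E ⧸ H) :
    ((mk (minWord H q) : FreeGroup E) : FreeGroup E ⧸ H) = q :=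
  wellFounded_shortlex.min_mem _ (exists_word_of_coset H q)

theorem not_shortlex_minWord (w : List (E × Bool)) :
    ¬ List.Shortlex WellOrderingRel w (minWord H ((mk w : FreeGroup E) : FreeGroup E ⧸ H)) :=
  wellFounded_shortlex.not_lt_min
    {v | ((mk v : FreeGroup E) : FreeGroup E ⧸ H) = ((mk w : FreeGroup E) : FreeGroup E ⧸ H)} rfl

theorem coe_mk_cons (s : E × Bool) (w : List (E × Bool)) :
    ((mk (s :: w) : FreeGroup E) : FreeGroup E ⧸ H) =
      (mk [s] : FreeGroup E) • ((mk w : FreeGroup E) : FreeGroup E ⧸ H) := by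
  rw [← List.singleton_append, ← mul_mk]
  rfl

/-- The Schreier property, for suffixes because the cosets are left cosets: a shortlex-smaller
representative of the coset of the tail would give a smaller one for q. -/
theorem eq_minWord_of_minWord_eq_cons {q : FreeGroup E ⧸ H} {s : E × Bool} {w : List (E × Bool)}
    (h : minWord H q = s :: w) : w = minWord H ((mk w : FreeGroup E) : FreeGroup E ⧸ H) := by
  set v := minWord H ((mk w : FreeGroup E) : FreeGroup E ⧸ H) with hv
  have h1 : ¬ List.Shortlex WellOrderingRel w v := not_shortlex_minWord H w
  have h2 : ¬ List.Shortlex WellOrderingRel v w := by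
    intro hlt
    have h3 : ((mk (s :: v) : FreeGroup E) : FreeGroup E ⧸ H) = q := by
      rw [coe_mk_cons, hv, mk_minWord, ← coe_mk_cons, ← h, mk_minWord]
    have h4 := not_shortlex_minWord H (s :: v)
    rw [h3, h] at h4
    exact h4 (List.Shortlex.append_left hlt [s])
  exact Std.Trichotomous.trichotomous (r := List.Shortlex WellOrderingRel) w v h1 h2

theorem minWord_one : minWord H ((1 : FreeGroup E) : FreeGroup E ⧸ H) = [] := by
  have h := not_shortlex_minWord H ([] : List (E × Bool))
  rw [← one_eq_mk] at h
  exact (List.shortlex_nil_or_eq_nil _).resolve_left h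

/-- The Schreier generator which belongs to a letter and a coset. -/
noncomputable def schreierGen (s : E × Bool) (q : FreeGroup E ⧸ H) : FreeGroup E :=
  (mk (minWord H ((mk [s] : FreeGroup E) • q)))⁻¹ * mk [s] * mk (minWord H q)

theorem schreierGen_mem (s : E × Bool) (q : FreeGroup E ⧸ H) : schreierGen H s q ∈ H := by
  rw [schreierGen, mul_assoc]
  refine QuotientGroup.eq.1 ?_
  rw [mk_minWord]
  conv_lhs => rw [← mk_minWord H q]
  rfl

theorem mk_singleton_false (e : E) : (mk [(e, false)] : FreeGroup E) = (of e)⁻¹ := by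
  simp [of, invRev]

theorem schreierGen_false (e : E) (q : FreeGroup E ⧸ H) :
    schreierGen H (e, false) q = (schreierGen H (e, true) ((of e)⁻¹ • q))⁻¹ := by
  simp only [schreierGen, mk_singleton_false]
  change _ = ((mk (minWord H (of e • _)))⁻¹ * of e * _)⁻¹
  rw [smul_inv_smul]
  group

section Crossing

open Classical in
/-- The action of the generator `e` on `Q × ℤ` which counts how often the edge `j` is crossed. -/
noncomputable def crossingPerm (j : E × (FreeGroup E ⧸ H)) (e : E) :
    Equiv.Perm ((FreeGroup E ⧸ H) × ℤ) where
  toFun x := (of e • x.1, x.2 + if j = (e, x.1) then 1 else 0)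
  invFun x := ((of e)⁻¹ • x.1, x.2 - if j = (e, (of e)⁻¹ • x.1) then 1 else 0)
  left_inv x := by simp
  right_inv x := by simp

/-- The signed number of crossings of the edge `j` on the way from the coset `q` to `g • q`. -/
noncomputable def crossings (j : E × (FreeGroup E ⧸ H)) (g : FreeGroup E) (q : FreeGroup E ⧸ H) :
    ℤ :=
  (lift (crossingPerm H j) g (q, 0)).2

variable (j : E × (FreeGroup E ⧸ H))

-- The permutations act on the second factor by translations that depend on the coset only. This
-- makes `crossings` a cocycle.
open Classical in
theorem lift_crossingPerm (g : FreeGroup E) (q : FreeGroup E ⧸ H) (n : ℤ) :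
    lift (crossingPerm H j) g (q, n) = (g • q, n + crossings H j g q) := by
  induction g using FreeGroup.induction_on generalizing q n with
  | C1 => simp [crossings]
  | of e => simp [crossings, crossingPerm]
  | inv_of e _ =>
    have h : ∀ x, (crossingPerm H j e)⁻¹ x =
        ((of e)⁻¹ • x.1, x.2 - if j = (e, (of e)⁻¹ • x.1) then 1 else 0) := fun _ => rfl
    simp only [crossings, _root_.map_inv, lift_apply_of, h]
    rw [zero_sub, sub_eq_add_neg]
  | mul g h hg hh =>
    have h1 : crossings H j (g * h) q = crossings H j h q + crossings H j g (h • q) := by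
      rw [crossings, _root_.map_mul, Equiv.Perm.mul_apply, hh, hg, zero_add]
    rw [_root_.map_mul, Equiv.Perm.mul_apply, hh, hg, h1, mul_smul, add_assoc]

theorem crossings_mul (g h : FreeGroup E) (q : FreeGroup E ⧸ H) :
    crossings H j (g * h) q = crossings H j h q + crossings H j g (h • q) := by
  rw [crossings, _root_.map_mul, Equiv.Perm.mul_apply, lift_crossingPerm, lift_crossingPerm]
  simp

theorem crossings_one (q : FreeGroup E ⧸ H) : crossings H j 1 q = 0 := by
  simp [crossings]

theorem crossings_inv (g : FreeGroup E) (q : FreeGroup E ⧸ H) :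
    crossings H j g⁻¹ q = - crossings H j g (g⁻¹ • q) := by
  have := crossings_mul H j g g⁻¹ q
  rw [mul_inv_cancel, crossings_one] at this
  linarith

open Classical in
theorem crossings_of (e : E) (q : FreeGroup E ⧸ H) :
    crossings H j (of e) q = if j = (e, q) then 1 else 0 := by
  simp [crossings, crossingPerm]

theorem crossings_eq_zero_of_schreierGen_eq_one {s : E × Bool} {q : FreeGroup E ⧸ H}
    (hj : schreierGen H (j.1, true) j.2 ≠ 1) (hs : schreierGen H s q = 1) :
    crossings H j (mk [s]) q = 0 := by
  obtain ⟨e, t⟩ := s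
  cases t
  · rw [schreierGen_false, inv_eq_one] at hs
    rw [mk_singleton_false, crossings_inv, crossings_of, if_neg, neg_zero]
    rintro rfl
    exact hj hs
  · change crossings H j (of e) q = 0
    rw [crossings_of, if_neg]
    rintro rfl
    exact hj hs

/-- By the Schreier property, the minimal word runs only through edges of the coset graph whose
Schreier generator is trivial. -/
theorem crossings_minWord (hj : schreierGen H (j.1, true) j.2 ≠ 1) (q : FreeGroup E ⧸ H) :
    crossings H j (mk (minWord H q)) ((1 : FreeGroup E) : FreeGroup E ⧸ H) = 0 := by
  generalize hw : minWord H q = w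
  induction w generalizing q with
  | nil => rw [← one_eq_mk, crossings_one]
  | cons s w ih =>
    have h1 := eq_minWord_of_minWord_eq_cons H hw
    have h2 := coe_mk_cons H s w
    rw [← hw, mk_minWord] at h2
    have h3 : ((mk w : FreeGroup E) • ((1 : FreeGroup E) : FreeGroup E ⧸ H)) =
        ((mk w : FreeGroup E) : FreeGroup E ⧸ H) := by
      rw [MulAction.Quotient.smul_coe, smul_eq_mul, mul_one]
    rw [← List.singleton_append, ← mul_mk, crossings_mul, ih _ h1.symm, zero_add, h3]
    refine crossings_eq_zero_of_schreierGen_eq_one H j hj ?_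
    rw [schreierGen, ← h2, hw, ← h1, mul_assoc, mul_mk, List.singleton_append, inv_mul_cancel]

open Classical in
theorem crossings_schreierGen (hj : schreierGen H (j.1, true) j.2 ≠ 1)
    (e : E) (q : FreeGroup E ⧸ H) :
    crossings H j (schreierGen H (e, true) q) ((1 : FreeGroup E) : FreeGroup E ⧸ H) =
      if j = (e, q) then 1 else 0 := by
  have h3 : ∀ q, ((mk (minWord H q) : FreeGroup E) • ((1 : FreeGroup E) : FreeGroup E ⧸ H)) = q := by
    intro q
    rw [MulAction.Quotient.smul_coe, smul_eq_mul, mul_one, mk_minWord]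
  rw [schreierGen, crossings_mul, crossings_minWord H j hj, crossings_mul, h3, crossings_inv]
  have : (mk [(e, true)] : FreeGroup E) = of e := rfl
  have h4 : (mk (minWord H (of e • q)) : FreeGroup E)⁻¹ • (of e • q) =
      ((1 : FreeGroup E) : FreeGroup E ⧸ H) := by
    rw [inv_smul_eq_iff, h3]
  rw [this, h4, crossings_minWord H j hj, crossings_of]
  simp

end Crossing

/-- On the image of c, crossing numbers are homomorphisms to ℤ, and those of the edges with
non-trivial Schreier generator are dual to these generators. A homomorphism is determined by its
values at the c(a_i), so the vectors of these values are independent. Hence there are at most k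
non-trivial Schreier generators. -/
theorem linearIndependent_crossings {k : ℕ} (c : FreeGroup (Fin k) →* FreeGroup E) :
    LinearIndependent ℚ fun (j : {j : E × (FreeGroup E ⧸ c.range) //
      schreierGen c.range (j.1, true) j.2 ≠ 1}) (i : Fin k) =>
        (crossings c.range j.1 (c (of i)) ((1 : FreeGroup E) : FreeGroup E ⧸ c.range) : ℚ) := by
  classical
  set o : FreeGroup E ⧸ c.range := ((1 : FreeGroup E) : FreeGroup E ⧸ c.range) with ho
  have hfix : ∀ g, c g • o = o := by
    intro g
    rw [ho, MulAction.Quotient.smul_coe, smul_eq_mul, mul_one]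
    exact QuotientGroup.eq.2 (by simp)
  rw [linearIndependent_iff']
  intro s x hx i hi
  -- A linear relation among the vectors is a homomorphism vanishing on the basis, hence everywhere;
  -- evaluation at the i-th Schreier generator isolates the i-th coefficient.
  let ψ : FreeGroup (Fin k) →* Multiplicative ℚ :=
    { toFun := fun g => Multiplicative.ofAdd
        (∑ j ∈ s, x j * (crossings c.range j.1 (c g) o : ℚ))
      map_one' := by simp [crossings_one]
      map_mul' := by
        intro g h
        rw [← ofAdd_add, ← Finset.sum_add_distrib]
        congr 1
        refine Finset.sum_congr rfl fun j _ => ?_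
        rw [_root_.map_mul, crossings_mul, hfix]
        push_cast
        ring }
  have hψ : ψ = 1 := by
    refine ext_hom _ _ fun a => ?_
    have := congrFun hx a
    simp only [Finset.sum_apply, Pi.smul_apply, smul_eq_mul, Pi.zero_apply] at this
    exact congrArg Multiplicative.ofAdd this
  obtain ⟨g, hg⟩ := schreierGen_mem c.range (i.1.1, true) i.1.2
  have h1 : ∑ j ∈ s, x j * (crossings c.range j.1 (c g) o : ℚ) = 0 :=
    congrArg Multiplicative.toAdd (DFunLike.congr_fun hψ g)
  rw [Finset.sum_eq_single i] at h1
  · rw [hg, crossings_schreierGen _ _ i.2] at h1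
    simpa using h1
  · intro j _ hj
    rw [hg, crossings_schreierGen _ _ j.2, if_neg fun h => hj (Subtype.ext h)]
    simp
  · exact fun h => absurd hi h

/-- The image of a free group of rank `k` in a free group is generated by `k` elements for which
the word length is at most the word length in the big free group. -/
theorem exists_hom_norm_le [DecidableEq E] {k : ℕ} (c : FreeGroup (Fin k) →* FreeGroup E) :
    ∃ f : FreeGroup (Fin k) →* FreeGroup E, ∀ g, ∃ w, w.norm ≤ (c g).norm ∧ f w = c g := by
  classical
  set J := {j : E × (FreeGroup E ⧸ c.range) // schreierGen c.range (j.1, true) j.2 ≠ 1}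
  have hli := linearIndependent_crossings c
  have : Finite J := hli.finite
  have : Fintype J := Fintype.ofFinite J
  have hcard : Fintype.card J ≤ Fintype.card (Fin k) := by
    simpa using hli.fintype_card_le_finrank
  obtain ⟨ι⟩ := Function.Embedding.nonempty_of_card_le hcard
  -- Letters not used for a non-trivial Schreier generator go to 1.
  let f₀ : Fin k → FreeGroup E :=
    Function.extend ι (fun j => schreierGen c.range (j.1.1, true) j.1.2) 1
  have hgen : ∀ e q, ∃ w : FreeGroup (Fin k), w.norm ≤ 1 ∧
      lift f₀ w = schreierGen c.range (e, true) q := by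
    intro e q
    by_cases h : schreierGen c.range (e, true) q = 1
    · exact ⟨1, by simp, by simp [h]⟩
    · refine ⟨of (ι ⟨(e, q), h⟩), by simp, ?_⟩
      rw [lift_apply_of]
      exact ι.injective.extend_apply _ _ _
  have hgen' : ∀ s q, ∃ w : FreeGroup (Fin k), w.norm ≤ 1 ∧
      lift f₀ w = schreierGen c.range s q := by
    rintro ⟨e, t⟩ q
    cases t
    · obtain ⟨w, hw, h⟩ := hgen e ((of e)⁻¹ • q)
      exact ⟨w⁻¹, by rwa [norm_inv_eq], by rw [_root_.map_inv, h, schreierGen_false]⟩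
    · exact hgen e q
  -- Schreier rewriting: each letter of u costs one Schreier generator, hence at most one letter,
  -- and the coset representatives telescope.
  have hword : ∀ (u : List (E × Bool)) (q : FreeGroup E ⧸ c.range), ∃ w : FreeGroup (Fin k),
      w.norm ≤ u.length ∧ lift f₀ w =
        (mk (minWord c.range ((mk u : FreeGroup E) • q)))⁻¹ * mk u * mk (minWord c.range q) := by
    intro u
    induction u with
    | nil =>
      intro q
      exact ⟨1, by simp, by
        rw [← one_eq_mk, one_smul, mul_one, inv_mul_cancel, _root_.map_one]⟩
    | cons s u ih =>
      intro q
      obtain ⟨w, hw, h⟩ := ih q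
      obtain ⟨v, hv, h'⟩ := hgen' s ((mk u : FreeGroup E) • q)
      refine ⟨v * w, (norm_mul_le _ _).trans (by simp; omega), ?_⟩
      have hsu : (mk (s :: u) : FreeGroup E) = mk [s] * mk u := by rw [mul_mk]; rfl
      rw [_root_.map_mul, h, h', schreierGen, hsu, mul_smul]
      group
  refine ⟨lift f₀, fun g => ?_⟩
  obtain ⟨w, hw, h⟩ := hword (c g).toWord ((1 : FreeGroup E) : FreeGroup E ⧸ c.range)
  refine ⟨w, hw, ?_⟩
  have hfix : c g • ((1 : FreeGroup E) : FreeGroup E ⧸ c.range) = (1 : FreeGroup E) := by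
    rw [MulAction.Quotient.smul_coe, smul_eq_mul, mul_one]
    exact QuotientGroup.eq.2 (by simp)
  rw [h, mk_toWord, hfix, minWord_one, ← one_eq_mk]
  simp

end Schreier

end FreeGroup

/-! ### Counting words, and the lower bound 1 -/

namespace FreeGroup

section Counting

variable {k : ℕ}

/-- The reduced words of length `n + 1`. -/
def reducedWords (k n : ℕ) : Finset (List (Fin k × Bool)) := Finset.univ.biUnion (wordsFrom n)

theorem mem_reducedWords {n : ℕ} {w : List (Fin k × Bool)} :
    w ∈ reducedWords k n ↔ IsReduced w ∧ w.length = n + 1 := by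
  simp only [reducedWords, Finset.mem_biUnion, Finset.mem_univ, true_and, mem_wordsFrom]
  constructor
  · rintro ⟨a, h1, h2, -⟩
    exact ⟨h1, h2⟩
  · rintro ⟨h1, h2⟩
    cases w with
    | nil => simp at h2
    | cons a w => exact ⟨a, h1, h2, rfl⟩

theorem average_eq_sum (n : ℕ) (f : List (Fin k × Bool) → ℝ) :
    average n f = (∑ w ∈ reducedWords k n, f w) / (2 * k * (2 * k - 1) ^ n) := by
  rw [reducedWords, Finset.sum_biUnion]
  · simp only [average, averageFrom, ← Finset.sum_div]
    rw [div_div, mul_comm]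
  · intro a _ b _ hab
    rw [Function.onFun, Finset.disjoint_left]
    intro w hw hw'
    rw [mem_wordsFrom] at hw hw'
    exact hab (Option.some.inj (hw.2.2.symm.trans hw'.2.2))

theorem card_reducedWords (hk : 2 ≤ k) (n : ℕ) :
    ((reducedWords k n).card : ℝ) = 2 * k * (2 * k - 1) ^ n := by
  have h3 := three_le_two_mul_sub_one hk
  have h2 : (2 : ℝ) ≤ k := by exact_mod_cast hk
  have h := average_const hk n (k := k) 1
  rw [average_eq_sum, div_eq_one_iff_eq (by positivity)] at h
  simpa using h

theorem finite_setOf_norm_le (k r : ℕ) : {w : FreeGroup (Fin k) | w.norm ≤ r}.Finite := by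
  refine Set.Finite.of_finite_image (f := toWord) ?_ toWord_injective.injOn
  refine (List.finite_length_le (Fin k × Bool) r).subset ?_
  rintro _ ⟨w, hw, rfl⟩
  exact hw

theorem ncard_setOf_norm_le (hk : 2 ≤ k) (r : ℕ) :
    ({w : FreeGroup (Fin k) | w.norm ≤ r}.ncard : ℝ) ≤ 2 * (2 * k - 1) ^ r := by
  have h3 := three_le_two_mul_sub_one hk
  have hsucc : ∀ r, {w : FreeGroup (Fin k) | w.norm ≤ r + 1} ⊆
      {w : FreeGroup (Fin k) | w.norm ≤ r} ∪ mk '' (reducedWords k r : Set (List (Fin k × Bool))) := by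
    intro r w hw
    by_cases h : w.norm ≤ r
    · exact Or.inl h
    · refine Or.inr ⟨w.toWord, ?_, mk_toWord⟩
      rw [Finset.mem_coe, mem_reducedWords]
      refine ⟨isReduced_toWord, ?_⟩
      rw [Set.mem_ofPred_eq] at hw
      simp only [norm] at *
      omega
  have h : ({w : FreeGroup (Fin k) | w.norm ≤ r}.ncard : ℝ) ≤ 2 * (2 * k - 1) ^ r - 1 := by
    induction r with
    | zero =>
      have : {w : FreeGroup (Fin k) | w.norm ≤ 0} = {1} := by
        ext w
        simp
      rw [this]
      norm_num
    | succ r ih =>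
      have h1 := (Set.ncard_le_ncard (hsucc r)
        ((finite_setOf_norm_le k r).union ((Finset.finite_toSet _).image _))).trans
        (Set.ncard_union_le _ _)
      have h2 := Set.ncard_image_le (f := (mk : _ → FreeGroup (Fin k)))
        (Finset.finite_toSet (reducedWords k r))
      rw [Set.ncard_coe_finset] at h2
      have h4 : ({w : FreeGroup (Fin k) | w.norm ≤ r + 1}.ncard : ℝ) ≤
          {w : FreeGroup (Fin k) | w.norm ≤ r}.ncard + (reducedWords k r).card := by
        exact_mod_cast h1.trans (by omega)
      rw [card_reducedWords hk] at h4
      have h5 : (0 : ℝ) < (2 * k - 1) ^ r := by positivity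
      rw [pow_succ]
      -- The sphere of radius r + 1 adds at most 2k(2k-1)^r elements, and 2 + 2k ≤ 2(2k-1) because k
      -- ≥ 2.
      nlinarith
  linarith

variable {E : Type*} [DecidableEq E] {c : FreeGroup (Fin k) →* FreeGroup E}

/-- A subgroup of rank `k` of a free group does not grow faster than the free group of rank `k`. -/
theorem exists_injOn_of_injective (hc : Function.Injective c) :
    ∃ f : FreeGroup (Fin k) → FreeGroup (Fin k), Function.Injective f ∧
      ∀ g, (f g).norm ≤ (c g).norm := by
  obtain ⟨f, hf⟩ := exists_hom_norm_le c
  choose w hw h using hf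
  exact ⟨w, fun g g' hg => hc (by rw [← h, ← h, hg]), hw⟩

theorem finite_setOf_norm_map_le (hc : Function.Injective c) (r : ℕ) :
    {g | (c g).norm ≤ r}.Finite := by
  obtain ⟨f, hf, hle⟩ := exists_injOn_of_injective hc
  refine Set.Finite.of_finite_image (f := f) ((finite_setOf_norm_le k r).subset ?_) hf.injOn
  rintro _ ⟨g, hg, rfl⟩
  exact (hle g).trans hg

theorem ncard_setOf_norm_map_le (hk : 2 ≤ k) (hc : Function.Injective c) (r : ℕ) :
    ({g | (c g).norm ≤ r}.ncard : ℝ) ≤ 2 * (2 * k - 1) ^ r := by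
  obtain ⟨f, hf, hle⟩ := exists_injOn_of_injective hc
  refine le_trans ?_ (ncard_setOf_norm_le hk r)
  rw [← Set.ncard_image_of_injective _ hf, Nat.cast_le]
  refine Set.ncard_le_ncard ?_ (finite_setOf_norm_le k r)
  rintro _ ⟨g, hg, rfl⟩
  exact (hle g).trans hg

theorem exists_lt_norm_map (hc : Function.Injective c) (D : ℕ) :
    ∃ m, ∀ g, m ≤ g.norm → D < (c g).norm := by
  obtain ⟨b, hb⟩ := ((finite_setOf_norm_map_le hc D).image norm).bddAbove
  refine ⟨b + 1, fun g hg => ?_⟩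
  by_contra! h
  have := hb (Set.mem_image_of_mem norm (Set.mem_ofPred_eq ▸ h : g ∈ {g | (c g).norm ≤ D}))
  omega

/-- Among the 2k(2k-1)^n words, at most 2(2k-1)^(n-s) have an image of length at most n - s, a
proportion of at most (2k-1)^(-s); all others contribute at least n - s. -/
theorem le_average_norm_map (hk : 2 ≤ k) (hc : Function.Injective c) {n s : ℕ} (hs : s ≤ n) :
    ((n - s : ℕ) : ℝ) * (1 - (1 / (2 * k - 1)) ^ s) ≤
      average n fun w => ((c (mk w)).norm : ℝ) := by
  classical
  have h3 := three_le_two_mul_sub_one hk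
  have h2 : (2 : ℝ) ≤ k := by exact_mod_cast hk
  set B := (reducedWords k n).filter fun w => (c (mk w)).norm ≤ n - s
  have hB : (B.card : ℝ) ≤ 2 * (2 * k - 1) ^ (n - s) := by
    refine le_trans ?_ (ncard_setOf_norm_map_le hk hc (n - s))
    rw [Nat.cast_le, ← Set.ncard_coe_finset]
    refine Set.ncard_le_ncard_of_injOn mk ?_ ?_ (finite_setOf_norm_map_le hc _)
    · intro w hw
      simp only [B, Finset.coe_filter, Set.mem_ofPred_eq] at hw
      exact hw.2
    · intro w hw v hv h
      simp only [B, Finset.coe_filter, Set.mem_ofPred_eq, mem_reducedWords] at hw hv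
      rw [← hw.1.1.reduce_eq, ← hv.1.1.reduce_eq]
      exact reduce.sound h
  have h1 : ((n - s : ℕ) : ℝ) * (1 - B.card / (2 * k * (2 * k - 1) ^ n)) ≤
      average n fun w => ((c (mk w)).norm : ℝ) := by
    have e1 : average n (fun w => ((n - s : ℕ) : ℝ) * (1 - if w ∈ B then 1 else 0)) =
        ((n - s : ℕ) : ℝ) * (1 - B.card / (2 * k * (2 * k - 1) ^ n)) := by
      rw [average_mul_left, average_sub, average_const hk, average_eq_sum]
      congr 3
      rw [Finset.sum_ite_mem, Finset.inter_eq_right.2 (Finset.filter_subset _ _)]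
      simp [B]
    rw [← e1]
    refine average_mono hk fun w hw hlen => ?_
    by_cases hwB : w ∈ B
    · simp [hwB]
    · have : ¬ (c (mk w)).norm ≤ n - s := fun h =>
        hwB (Finset.mem_filter.2 ⟨mem_reducedWords.2 ⟨hw, hlen⟩, h⟩)
      simp only [hwB, if_false, sub_zero, mul_one, Nat.cast_le]
      omega
  refine le_trans (mul_le_mul_of_nonneg_left ?_ (Nat.cast_nonneg _)) h1
  refine sub_le_sub_left ?_ _
  rw [div_le_iff₀ (by positivity)]
  refine hB.trans ?_
  obtain ⟨j, rfl⟩ := Nat.exists_eq_add_of_le hs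
  rw [Nat.add_sub_cancel_left, pow_add, one_div, inv_pow]
  have h5 : (0 : ℝ) < (2 * k - 1) ^ j := by positivity
  have h6 : (0 : ℝ) < (2 * k - 1) ^ s := by positivity
  field_simp
  linarith

end Counting

/-- The stretching factor of an injective homomorphism of free groups is at least `1`. -/
theorem one_le_averageIncrement {k : ℕ} (hk : 2 ≤ k) {E : Type*} [DecidableEq E]
    {c : FreeGroup (Fin k) →* FreeGroup E} (hc : Function.Injective c) {D m : ℕ}
    (hD : ∀ i, (c (of i)).norm ≤ D) (hm : ∀ g : FreeGroup (Fin k), m ≤ g.norm → D < (c g).norm) :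
    1 ≤ averageIncrement m fun w => ((c (mk w)).norm : ℝ) := by
  have h3 := three_le_two_mul_sub_one hk
  set lam := averageIncrement m fun w => ((c (mk w)).norm : ℝ)
  have hs : ∀ s : ℕ, 1 - (1 / (2 * (k : ℝ) - 1)) ^ s ≤ lam := by
    intro s
    set ε := 1 - (1 / (2 * (k : ℝ) - 1)) ^ s
    set A := average m fun w => ((c (mk w)).norm : ℝ)
    -- The mean at index m + j is A + j·lam and is at least (m + j - s)ε; dividing by j gives ε ≤
    -- lam in the limit.
    have h1 : Tendsto (fun j : ℕ => (A - (m : ℝ) * ε + s * ε) / j + lam) atTop (𝓝 (0 + lam)) :=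
      (tendsto_const_div_atTop_nhds_zero_nat _).add_const _
    rw [zero_add] at h1
    refine ge_of_tendsto h1 ?_
    filter_upwards [eventually_ge_atTop (s + 1)] with j hj
    have h2 := le_average_norm_map hk hc (n := m + j) (s := s) (by omega)
    rw [average_eq_add_mul hk fun w hw hlen => norm_increment_eq c hD hm hw hlen,
      Nat.cast_sub (by omega)] at h2
    push_cast at h2
    have hj0 : (0 : ℝ) < j := by exact_mod_cast (by omega : 0 < j)
    change ((m : ℝ) + j - s) * ε ≤ A + j * lam at h2
    have : (A - (m : ℝ) * ε + s * ε) / j + lam - ε = (A + j * lam - ((m : ℝ) + j - s) * ε) / j := by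
      field_simp
      ring
    have h4 : 0 ≤ (A + j * lam - ((m : ℝ) + j - s) * ε) / j := div_nonneg (by linarith) hj0.le
    linarith
  have h1 : Tendsto (fun s : ℕ => 1 - (1 / (2 * (k : ℝ) - 1)) ^ s) atTop (𝓝 (1 - 0)) := by
    refine (tendsto_pow_atTop_nhds_zero_of_lt_one (by positivity) ?_).const_sub 1
    rw [div_lt_one (by linarith)]
    linarith
  rw [sub_zero] at h1
  exact le_of_tendsto' h1 hs

theorem averageIncrement_eq_div {k : ℕ} (m : ℕ) (N : List (Fin k × Bool) → ℕ) :
    averageIncrement m (fun w => (N w : ℝ)) =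
      ((∑ w ∈ reducedWords k m, (N w : ℤ) - ∑ w ∈ reducedWords k m, (N w.tail : ℤ) : ℤ) : ℝ) /
        (2 * k * (2 * k - 1) ^ m) := by
  rw [averageIncrement, average_eq_sum]
  push_cast
  rw [Finset.sum_sub_distrib]

end FreeGroup

/-- The generic stretching factor of an injective homomorphism of free groups. -/
theorem exists_isGenericStretchingFactor_norm_map {k : ℕ} (hk : 2 ≤ k) {E : Type*} [DecidableEq E]
    (c : FreeGroup (Fin k) →* FreeGroup E) (hc : Function.Injective c) :
    ∃ lam : ℚ, IsGenericStretchingFactor hk (fun g => (c g).norm) lam ∧ 1 ≤ lam ∧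
      2 * (k : ℚ) * lam ∈ Algebra.adjoin ℤ {(1 / (2 * (k : ℚ) - 1))} := by
  have h3 : (3 : ℚ) ≤ 2 * k - 1 := by
    have : (2 : ℚ) ≤ k := by exact_mod_cast hk
    linarith
  have h2 : (2 : ℚ) ≤ k := by exact_mod_cast hk
  obtain ⟨D, hD⟩ : ∃ D, ∀ i, (c (.of i)).norm ≤ D :=
    ⟨∑ i, (c (.of i)).norm, fun i =>
      Finset.single_le_sum (f := fun i => (c (.of i)).norm) (fun _ _ => Nat.zero_le _)
        (Finset.mem_univ i)⟩
  obtain ⟨m, hm⟩ := FreeGroup.exists_lt_norm_map hc D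
  have h1 := isGenericStretchingFactor_norm_map hk c hD hm
  have h4 := FreeGroup.one_le_averageIncrement hk hc hD hm
  have h5 := FreeGroup.averageIncrement_eq_div m fun w : List (Fin k × Bool) =>
    (c (FreeGroup.mk w)).norm
  generalize hz : (∑ w ∈ FreeGroup.reducedWords k m, ((c (FreeGroup.mk w)).norm : ℤ) -
    ∑ w ∈ FreeGroup.reducedWords k m, ((c (FreeGroup.mk w.tail)).norm : ℤ) : ℤ) = z at h5
  have h6 : FreeGroup.averageIncrement m (fun w => ((c (FreeGroup.mk w)).norm : ℝ)) =
      ((z / (2 * k * (2 * k - 1) ^ m) : ℚ) : ℝ) := by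
    rw [h5]
    push_cast
    rfl
  rw [h6] at h1 h4
  refine ⟨_, h1, by exact_mod_cast h4, ?_⟩
  have h7 : 2 * (k : ℚ) * (z / (2 * k * (2 * k - 1) ^ m)) = z • (1 / (2 * (k : ℚ) - 1)) ^ m := by
    rw [zsmul_eq_mul, one_div, inv_pow]
    field_simp
  rw [h7]
  exact Subalgebra.smul_mem _ (pow_mem (Algebra.self_mem_adjoin_singleton _ _) _) _

/-! ### Independence of the base-point -/

section BasePoint

variable {k : ℕ} {V : Type*} {X : SimpleGraph V} (φ : FreeGroup (Fin k) →* (X ≃g X))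

theorem SimpleGraph.Connected.dist_map_eq (hX : X.Connected) (f : X ≃g X) (u v : V) :
    X.dist (f u) (f v) = X.dist u v := by
  have key : ∀ (f : X ≃g X) (u v : V), X.dist (f u) (f v) ≤ X.dist u v := by
    intro f u v
    obtain ⟨p, hp⟩ := hX.exists_walk_length_eq_dist u v
    rw [← hp, ← SimpleGraph.Walk.length_map f.toHom p]
    exact SimpleGraph.dist_le _
  refine le_antisymm (key f u v) ?_
  simpa using key f.symm (f u) (f v)

theorem SimpleGraph.Connected.exists_dist_le (hX : X.Connected) (x : V) :
    ∃ D : ℕ, ∀ w : List (Fin k × Bool), X.dist x (φ (FreeGroup.mk w) x) ≤ w.length * D := by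
  refine ⟨∑ a, X.dist x (φ (FreeGroup.mk [a]) x), fun w => ?_⟩
  induction w with
  | nil => simp [← FreeGroup.one_eq_mk]
  | cons a w ih =>
    rw [← List.singleton_append, ← FreeGroup.mul_mk, map_mul]
    have h1 := hX.dist_triangle (u := x) (v := φ (FreeGroup.mk [a]) x)
      (w := φ (FreeGroup.mk [a]) (φ (FreeGroup.mk w) x))
    rw [hX.dist_map_eq] at h1
    have h2 := Finset.single_le_sum (f := fun a => X.dist x (φ (FreeGroup.mk [a]) x))
      (fun _ _ => Nat.zero_le _) (Finset.mem_univ a)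
    simp only [List.singleton_append, List.length_cons, RelIso.mul_apply] at *
    rw [add_mul, one_mul]
    omega

/-- The existence and the value of the stretching factor do not depend on the base-point. -/
theorem isActionStretchingFactor_of_basePoint {hk : 2 ≤ k} (hX : X.Connected) (x : V) {lam : ℝ}
    (h : IsGenericStretchingFactor hk (fun g => (X.dist x (φ g x) : ℝ)) lam) :
    IsActionStretchingFactor hk φ lam := by
  intro y
  obtain ⟨D, hD⟩ := hX.exists_dist_le φ y
  refine h.of_bounded_sub (D := D) (C := 2 * X.dist x y) (fun ω n => ?_) fun g => ?_
  · have := hD (ω.initialWord n)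
    rw [FreeBoundary.length_initialWord] at this
    rw [Nat.abs_cast]
    exact_mod_cast this
  · have h1 := hX.dist_triangle (u := y) (v := x) (w := φ g y)
    have h2 := hX.dist_triangle (u := x) (v := φ g x) (w := φ g y)
    have h3 := hX.dist_triangle (u := x) (v := y) (w := φ g x)
    have h4 := hX.dist_triangle (u := y) (v := φ g y) (w := φ g x)
    have h5 := hX.dist_map_eq (φ g) x y
    have h6 := hX.dist_map_eq (φ g) y x
    have h7 := X.dist_comm (u := x) (v := y)
    rw [abs_le]
    constructor
    · have : X.dist x (φ g x) ≤ X.dist y (φ g y) + 2 * X.dist x y := by omega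
      have : (X.dist x (φ g x) : ℝ) ≤ X.dist y (φ g y) + 2 * X.dist x y := by exact_mod_cast this
      linarith
    · have : X.dist y (φ g y) ≤ X.dist x (φ g x) + 2 * X.dist x y := by omega
      have : (X.dist y (φ g y) : ℝ) ≤ X.dist x (φ g x) + 2 * X.dist x y := by exact_mod_cast this
      linarith

end BasePoint

/-! ### From actions on trees to homomorphisms of free groups -/

namespace SimpleGraph

section Labels

variable {V : Type*} {X : SimpleGraph V} {E : Type*}

/-- The word which one reads along a walk if the oriented edges are labelled. -/
def Walk.readWord (lab : V → V → E × Bool) {u v : V} (p : X.Walk u v) : List (E × Bool) :=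
  p.darts.map fun d => lab d.fst d.snd

variable {lab : V → V → E × Bool}

theorem Walk.readWord_append {u v w : V} (p : X.Walk u v) (q : X.Walk v w) :
    (p.append q).readWord lab = p.readWord lab ++ q.readWord lab := by
  simp [readWord]

theorem Walk.readWord_cons {u v w : V} (h : X.Adj u v) (p : X.Walk v w) :
    (Walk.cons h p).readWord lab = lab u v :: p.readWord lab := rfl

theorem Walk.length_readWord {u v : V} (p : X.Walk u v) : (p.readWord lab).length = p.length := by
  simp [readWord]

/-- In a tree, prepending an edge to a path either extends it or backtracks along its first edge,
and in the second case the labels cancel. So the group element depends on the endpoints only. -/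
theorem IsTree.mk_readWord_eq (hX : X.IsTree)
    (hflip : ∀ u v, X.Adj u v → lab v u = ((lab u v).1, !(lab u v).2)) {u v : V}
    (p : X.Walk u v) {q : X.Walk u v} (hq : q.IsPath) :
    FreeGroup.mk (p.readWord lab) = FreeGroup.mk (q.readWord lab) := by
  induction p with
  | nil =>
    rw [(Walk.isPath_iff_nil.1 hq).eq_nil]
  | @cons u u' v h p ih =>
    obtain ⟨q', hq', -⟩ := hX.existsUnique_path u' v
    rw [Walk.readWord_cons, ← List.singleton_append, ← FreeGroup.mul_mk, ih hq']
    by_cases hu : u ∈ q'.support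
    · have hu' : u' ∉ q.support := by
        have := hX.isAcyclic.ne_mem_support_of_support_of_adj_of_isPath hq'.reverse hq.reverse h.symm
          (by simpa using hu)
        simpa using this
      have : q' = Walk.cons h.symm q :=
        (hX.existsUnique_path u' v).unique hq' (hq.cons hu')
      rw [this, Walk.readWord_cons, FreeGroup.mul_mk, hflip u u' h, List.singleton_append]
      exact Quot.sound FreeGroup.Red.Step.cons_not
    · have : q = Walk.cons h q' := (hX.existsUnique_path u v).unique hq (hq'.cons hu)
      rw [this, Walk.readWord_cons, FreeGroup.mul_mk, List.singleton_append]

/-- Labels are injective at each vertex, so cancelling consecutive labels would mean that the path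
backtracks. -/
theorem Walk.IsPath.isReduced_readWord
    (hflip : ∀ u v, X.Adj u v → lab v u = ((lab u v).1, !(lab u v).2))
    (hinj : ∀ u v w, X.Adj u v → X.Adj u w → lab u v = lab u w → v = w) {u v : V}
    {p : X.Walk u v} (hp : p.IsPath) : FreeGroup.IsReduced (p.readWord lab) := by
  induction p with
  | nil => exact List.IsChain.nil
  | @cons u u' v h p ih =>
    rw [Walk.cons_isPath_iff] at hp
    have := ih hp.1
    cases p with
    | nil => exact List.IsChain.singleton _
    | @cons _ u'' _ h' p =>
      rw [Walk.readWord_cons, Walk.readWord_cons, FreeGroup.isReduced_cons_cons]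
      refine ⟨fun h1 => ?_, this⟩
      by_contra h2
      have h3 : lab u' u = lab u' u'' := by
        rw [hflip u u' h]
        ext
        · exact h1
        · revert h2
          cases (lab u u').2 <;> cases (lab u' u'').2 <;> simp
      have h4 := hinj u' u u'' h.symm h' h3
      exact hp.2 (by simp [h4])

variable {G : Type*} [Group G]

/-- A group which acts on a tree preserving a suitable labelling of the oriented edges maps to
the free group on the set of labels. -/
theorem IsTree.exists_hom_norm_eq_dist [DecidableEq E] (hX : X.IsTree)
    (hflip : ∀ u v, X.Adj u v → lab v u = ((lab u v).1, !(lab u v).2))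
    (hinj : ∀ u v w, X.Adj u v → X.Adj u w → lab u v = lab u w → v = w)
    (φ : G →* (X ≃g X)) (hφ : ∀ g u v, lab (φ g u) (φ g v) = lab u v) (x : V) :
    ∃ c : G →* FreeGroup E, ∀ g, (c g).norm = X.dist x (φ g x) := by
  have hex : ∀ u v, ∃ p : X.Walk u v, p.IsPath ∧ p.length = X.dist u v := fun u v =>
    hX.connected.exists_path_of_dist u v
  choose P hP hlen using hex
  have hmk : ∀ {u v : V} (p : X.Walk u v),
      FreeGroup.mk (p.readWord lab) = FreeGroup.mk ((P u v).readWord lab) := fun p =>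
    hX.mk_readWord_eq hflip p (hP _ _)
  let c : G →* FreeGroup E := MonoidHom.mk' (fun g => FreeGroup.mk ((P x (φ g x)).readWord lab)) <| by
    intro g h
    rw [FreeGroup.mul_mk]
    -- The walk from x to gx followed by the g-translate of the path from x to hx ends at ghx, and
    -- translation preserves the labels.
    have h1 : (P x (φ h x)).readWord lab =
        ((P x (φ h x)).map (φ g).toHom).readWord lab := by
      simp only [Walk.readWord, Walk.darts_map, List.map_map]
      refine List.map_congr_left fun d _ => ?_
      exact (hφ g d.fst d.snd).symm
    rw [h1, map_mul]
    exact (hmk ((P x (φ g x)).append ((P x (φ h x)).map (φ g).toHom))).symm.trans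
      (congrArg _ (Walk.readWord_append _ _))
  refine ⟨c, fun g => ?_⟩
  rw [← hlen, ← Walk.length_readWord (lab := lab) (P x (φ g x)), FreeGroup.norm]
  change (FreeGroup.mk _).toWord.length = _
  rw [FreeGroup.toWord_mk, ((hP _ _).isReduced_readWord hflip hinj).reduce_eq]

end Labels

section Orbits

variable {V : Type*} {X : SimpleGraph V} {G : Type*} [Group G] (φ : G →* (X ≃g X))

/-- The orbit relation on pairs of vertices. -/
def pairSetoid : Setoid (V × V) where
  r x y := ∃ g, φ g x.1 = y.1 ∧ φ g x.2 = y.2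
  iseqv :=
    { refl := fun x => ⟨1, by simp⟩
      symm := by
        rintro x y ⟨g, h1, h2⟩
        refine ⟨g⁻¹, ?_, ?_⟩
        · rw [← h1, ← RelIso.mul_apply, ← map_mul, inv_mul_cancel, map_one, RelIso.one_apply]
        · rw [← h2, ← RelIso.mul_apply, ← map_mul, inv_mul_cancel, map_one, RelIso.one_apply]
      trans := by
        rintro x y z ⟨g, h1, h2⟩ ⟨h, h3, h4⟩
        exact ⟨h * g, by rw [map_mul, RelIso.mul_apply, h1, h3],
          by rw [map_mul, RelIso.mul_apply, h2, h4]⟩ }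

open Classical in
/-- The labelling of oriented edges by their orbits. -/
noncomputable def orbitLabel (u v : V) : Quotient (pairSetoid φ) × Bool :=
  if WellOrderingRel (Quotient.mk (pairSetoid φ) (u, v)) (Quotient.mk (pairSetoid φ) (v, u)) then
    (Quotient.mk _ (u, v), true) else (Quotient.mk _ (v, u), false)

theorem orbitLabel_map (g : G) (u v : V) : orbitLabel φ (φ g u) (φ g v) = orbitLabel φ u v := by
  have h : ∀ u v, Quotient.mk (pairSetoid φ) (φ g u, φ g v) = Quotient.mk (pairSetoid φ) (u, v) :=
    fun u v => Quotient.sound ((pairSetoid φ).symm ⟨g, rfl, rfl⟩)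
  rw [orbitLabel, h, h, orbitLabel]

/-- Without inversions the two orientations of an edge lie in different orbits, so the well-order
selects exactly one of them. -/
theorem orbitLabel_swap (hφ : WithoutInversions φ) {u v : V} (h : X.Adj u v) :
    orbitLabel φ v u = ((orbitLabel φ u v).1, !(orbitLabel φ u v).2) := by
  have hne : Quotient.mk (pairSetoid φ) (u, v) ≠ Quotient.mk (pairSetoid φ) (v, u) := by
    intro he
    obtain ⟨g, h1, h2⟩ := Quotient.exact he
    exact hφ g u v h ⟨h1, h2⟩
  unfold orbitLabel
  by_cases h1 : WellOrderingRel (Quotient.mk (pairSetoid φ) (u, v))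
      (Quotient.mk (pairSetoid φ) (v, u))
  · have h2 := asymm h1
    simp [h1, h2]
  · have h2 : WellOrderingRel (Quotient.mk (pairSetoid φ) (v, u))
        (Quotient.mk (pairSetoid φ) (u, v)) := by
      by_contra h2
      exact hne (Std.Trichotomous.trichotomous (r := WellOrderingRel) _ _ h1 h2)
    simp [h1, h2]

theorem eq_of_orbitLabel_eq (hφ : IsFreeAction φ) {u v w : V}
    (h : orbitLabel φ u v = orbitLabel φ u w) : v = w := by
  have key : Quotient.mk (pairSetoid φ) (u, v) = Quotient.mk (pairSetoid φ) (u, w) := by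
    unfold orbitLabel at h
    split_ifs at h
    · exact (Prod.mk.inj h).1
    · simp at h
    · simp at h
    · obtain ⟨g, h1, h2⟩ := Quotient.exact (Prod.mk.inj h).1
      exact Quotient.sound ⟨g, h2, h1⟩
  obtain ⟨g, h1, h2⟩ := Quotient.exact key
  have := hφ g u h1
  subst this
  simpa using h2

end Orbits

end SimpleGraph

/-- Free actions without inversions on trees have rational stretching factors. -/
theorem exists_isActionStretchingFactor {k : ℕ} (hk : 2 ≤ k) {V : Type*} {X : SimpleGraph V}
    (φ : FreeGroup (Fin k) →* (X ≃g X)) (hX : X.IsTree) (hfree : IsFreeAction φ)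
    (hinv : WithoutInversions φ) :
    ∃ lam : ℚ, IsActionStretchingFactor hk φ (lam : ℝ) ∧ 1 ≤ lam ∧
      2 * (k : ℚ) * lam ∈ Algebra.adjoin ℤ {(1 / (2 * (k : ℚ) - 1))} := by
  classical
  obtain ⟨x⟩ := hX.connected.nonempty
  obtain ⟨c, hc⟩ := hX.exists_hom_norm_eq_dist (fun u v h => SimpleGraph.orbitLabel_swap φ hinv h)
    (fun u v w _ _ h => SimpleGraph.eq_of_orbitLabel_eq φ hfree h) φ
    (SimpleGraph.orbitLabel_map φ) x
  have hinj : Function.Injective c := by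
    rw [injective_iff_map_eq_one]
    intro g hg
    have h1 := hc g
    rw [hg, FreeGroup.norm_one, eq_comm, hX.connected.dist_eq_zero_iff] at h1
    exact hfree g x h1.symm
  obtain ⟨lam, h1, h2, h3⟩ := exists_isGenericStretchingFactor_norm_map hk c hinj
  refine ⟨lam, isActionStretchingFactor_of_basePoint φ hX.connected x ?_, h2, h3⟩
  simpa only [hc] using h1

/-! ### Distances in the universal cover of a finite graph -/

namespace FiniteGraph

variable {Γ : FiniteGraph}

/-- An edge crossed in either direction. -/
def Step (u v : Γ.Vertex) : Type := (u ⟶ v) ⊕ (v ⟶ u)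

/-- The same edge crossed in the opposite direction. -/
def Step.flip {u v : Γ.Vertex} (e : Step u v) : Step v u := Sum.swap e

/-- The letter which encodes an edge crossed in either direction. -/
def edgeCode {u v : Γ.Vertex} : Step u v → ℕ × Bool
  | Sum.inl e => ((e.1 : Fin Γ.numEdges).1, true)
  | Sum.inr e => ((e.1 : Fin Γ.numEdges).1, false)

/-- The constant edge-path. -/
def nilPath (u : Γ.Vertex) : Γ.EdgePath u u :=
  @Quiver.Path.nil (Quiver.Symmetrify Γ.Vertex) _ u

/-- The edge-path `γ` continued with the edge `e`. -/
def snoc {u v w : Γ.Vertex} (γ : Γ.EdgePath u v) (e : Step v w) : Γ.EdgePath u w :=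
  @Quiver.Path.cons (Quiver.Symmetrify Γ.Vertex) _ u v w γ e

/-- Concatenation of edge-paths. -/
def append {u v w : Γ.Vertex} (γ : Γ.EdgePath u v) (δ : Γ.EdgePath v w) : Γ.EdgePath u w :=
  @Quiver.Path.comp (Quiver.Symmetrify Γ.Vertex) _ u v w γ δ

theorem append_nilPath {u v : Γ.Vertex} (γ : Γ.EdgePath u v) : append γ (nilPath v) = γ := rfl

theorem append_snoc {u v w x : Γ.Vertex} (γ : Γ.EdgePath u v) (δ : Γ.EdgePath v w)
    (e : Step w x) : append γ (snoc δ e) = snoc (append γ δ) e := rfl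

theorem edgePath_induction {u : Γ.Vertex} {P : ∀ {v : Γ.Vertex}, Γ.EdgePath u v → Prop}
    (nil : P (nilPath u))
    (snoc : ∀ {v w : Γ.Vertex} (γ : Γ.EdgePath u v) (e : Step v w), P γ → P (snoc γ e))
    {v : Γ.Vertex} (γ : Γ.EdgePath u v) : P γ :=
  @Quiver.Path.rec (Quiver.Symmetrify Γ.Vertex) _ u (fun v γ => @P v γ) nil
    (fun {_ _} γ e ih => snoc γ e ih) v γ

theorem pathCode_nilPath (u : Γ.Vertex) : MarkedGraph.pathCode (nilPath u) = [] := rfl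

theorem pathCode_snoc {u v w : Γ.Vertex} (γ : Γ.EdgePath u v) (e : Step v w) :
    MarkedGraph.pathCode (snoc γ e) = MarkedGraph.pathCode γ ++ [edgeCode e] := by
  obtain e | e := e <;> rfl

theorem pathCode_append {u v w : Γ.Vertex} (γ : Γ.EdgePath u v) (δ : Γ.EdgePath v w) :
    MarkedGraph.pathCode (append γ δ) = MarkedGraph.pathCode γ ++ MarkedGraph.pathCode δ := by
  induction δ using edgePath_induction with
  | nil => exact (List.append_nil _).symm
  | snoc δ e ih => rw [append_snoc, pathCode_snoc, pathCode_snoc, ih, List.append_assoc]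

theorem edgeCode_flip {u v : Γ.Vertex} (e : Step u v) :
    edgeCode e.flip = ((edgeCode e).1, !(edgeCode e).2) := by
  obtain e | e := e <;> rfl

/-- A code forgets endpoints, but composable steps with inverse codes cross the same edge, so the
second leads back to the start. -/
theorem eq_flip_of_edgeCode {u v w : Γ.Vertex} {e : Step u v} {f : Step v w}
    (h : edgeCode f = ((edgeCode e).1, !(edgeCode e).2)) :
    ∃ h : w = u, f = h ▸ e.flip := by
  obtain e | e := e <;> obtain f | f := f <;>
    simp only [edgeCode, Bool.not_true, Bool.not_false, Prod.mk.injEq, reduceCtorEq, and_false,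
      and_true] at h
  · obtain ⟨e, rfl, rfl⟩ := e
    obtain ⟨f, rfl, h1⟩ := f
    obtain rfl : f = e := Fin.ext h
    exact ⟨rfl, rfl⟩
  · obtain ⟨e, rfl, rfl⟩ := e
    obtain ⟨f, h1, rfl⟩ := f
    obtain rfl : f = e := Fin.ext h
    exact ⟨rfl, rfl⟩

theorem pathClass_append {u v w : Γ.Vertex} (γ : Γ.EdgePath u v) (δ : Γ.EdgePath v w) :
    pathClass (append γ δ) = pathClass γ ≫ pathClass δ :=
  (CategoryTheory.Quotient.functor (Quiver.FreeGroupoid.redStep (V := Γ.Vertex))).map_comp γ δ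

/-- The homotopy class of a single edge crossed in either direction. -/
def stepClass {u v : Γ.Vertex} (e : Step u v) : Γ.HomotopyClass u v :=
  pathClass (snoc (nilPath u) e)

theorem pathClass_snoc {u v w : Γ.Vertex} (γ : Γ.EdgePath u v) (e : Step v w) :
    pathClass (snoc γ e) = pathClass γ ≫ stepClass e := by
  rw [stepClass, ← pathClass_append, append_snoc, append_nilPath]

theorem stepClass_inl {u v : Γ.Vertex} (e : u ⟶ v) :
    stepClass (Sum.inl e : Step u v) = edgeClass e := rfl

theorem stepClass_comp_flip {u v : Γ.Vertex} (e : Step u v) :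
    stepClass e ≫ stepClass e.flip = 𝟙 _ := by
  rw [stepClass, stepClass, ← pathClass_append]
  exact (CategoryTheory.Quotient.sound _ (@Quiver.FreeGroupoid.redStep.step Γ.Vertex _ u v e)).symm

theorem exists_pathClass_eq {u v : Γ.Vertex} (a : Γ.HomotopyClass u v) :
    ∃ γ : Γ.EdgePath u v, pathClass γ = a := Quot.exists_rep a

/-- Every edge-path is homotopic to a reduced one. -/
theorem exists_isReduced_pathCode {u v : Γ.Vertex} (γ : Γ.EdgePath u v) :
    ∃ δ : Γ.EdgePath u v, pathClass δ = pathClass γ ∧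
      FreeGroup.IsReduced (MarkedGraph.pathCode δ) := by
  have key : ∀ {v w : Γ.Vertex} (δ : Γ.EdgePath u v) (f : Step v w),
      FreeGroup.IsReduced (MarkedGraph.pathCode δ) → ∃ ε : Γ.EdgePath u w,
        pathClass ε = pathClass (snoc δ f) ∧ FreeGroup.IsReduced (MarkedGraph.pathCode ε) := by
    intro v w δ f
    induction δ using edgePath_induction with
    | nil =>
      intro _
      exact ⟨_, rfl, by rw [pathCode_snoc]; exact List.IsChain.singleton _⟩
    | snoc δ e _ =>
      intro h2
      by_cases h4 : edgeCode f = ((edgeCode e).1, !(edgeCode e).2)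
      · obtain ⟨rfl, rfl⟩ := eq_flip_of_edgeCode h4
        refine ⟨δ, ?_, ?_⟩
        · rw [pathClass_snoc, pathClass_snoc, Category.assoc, stepClass_comp_flip,
            Category.comp_id]
        · rw [pathCode_snoc] at h2
          exact h2.infix ⟨[], [edgeCode e], by simp⟩
      · refine ⟨_, rfl, ?_⟩
        rw [pathCode_snoc] at h2 ⊢
        rw [pathCode_snoc]
        unfold FreeGroup.IsReduced at *
        rw [List.isChain_append]
        refine ⟨h2, List.isChain_singleton _, ?_⟩
        intro x hx y hy
        simp only [List.getLast?_append, List.getLast?_singleton, Option.some_or, Option.mem_def,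
          Option.some.injEq, List.head?_cons] at hx hy
        subst hx hy
        intro h5
        by_contra h6
        apply h4
        ext
        · exact h5.symm
        · revert h6
          cases (edgeCode e).2 <;> cases (edgeCode f).2 <;> simp
  induction γ using edgePath_induction with
  | nil => exact ⟨_, rfl, List.IsChain.nil⟩
  | snoc γ f ih =>
    obtain ⟨δ, h1, h2⟩ := ih
    obtain ⟨ε, h3, h4⟩ := key δ f h2
    exact ⟨ε, by rw [h3, pathClass_snoc, h1, pathClass_snoc], h4⟩

theorem mk_pathCode_insert {u v x y : Γ.Vertex} (α : Γ.EdgePath u x) (e : Step x y)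
    (β : Γ.EdgePath x v) :
    FreeGroup.mk (MarkedGraph.pathCode (append α (append (nilPath x) β))) =
      FreeGroup.mk (MarkedGraph.pathCode (append α
        (append (append (snoc (nilPath x) e) (snoc (nilPath y) e.flip)) β))) := by
  rw [pathCode_append, pathCode_append, pathCode_append, pathCode_append, pathCode_append,
    pathCode_snoc, pathCode_snoc, pathCode_nilPath, pathCode_nilPath, edgeCode_flip]
  exact (Quot.sound (FreeGroup.Red.Step.append_left FreeGroup.Red.Step.cons_not)).symm

/-- The element of the free group on the edges which is represented by a homotopy class. -/
def readClass {u v : Γ.Vertex} (a : Γ.HomotopyClass u v) : FreeGroup ℕ :=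
  Quot.lift (fun γ : Γ.EdgePath u v => FreeGroup.mk (MarkedGraph.pathCode γ)) (by
    rintro _ _ ⟨_, _, α, _, _, β, ⟨x, y, e⟩⟩
    exact mk_pathCode_insert (Γ := Γ) α e β) a

theorem readClass_pathClass {u v : Γ.Vertex} (γ : Γ.EdgePath u v) :
    readClass (pathClass γ) = FreeGroup.mk (MarkedGraph.pathCode γ) := rfl

theorem readClass_comp {u v w : Γ.Vertex} (a : Γ.HomotopyClass u v) (b : Γ.HomotopyClass v w) :
    readClass (a ≫ b) = readClass a * readClass b := by
  obtain ⟨γ, rfl⟩ := exists_pathClass_eq a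
  obtain ⟨δ, rfl⟩ := exists_pathClass_eq b
  rw [← pathClass_append, readClass_pathClass, readClass_pathClass, readClass_pathClass,
    pathCode_append, FreeGroup.mul_mk]

theorem readClass_edgeClass {u v : Γ.Vertex} (e : u ⟶ v) :
    readClass (edgeClass e) = FreeGroup.of (e.1 : Fin Γ.numEdges).1 := rfl

variable {p : Γ.Vertex}

/-- The equality case is admitted because `SimpleGraph.fromRel` requires distinct vertices; it is
harmless, as only an upper bound on the length of walks is derived. -/
theorem eq_or_adj_comp_stepClass {v w : Γ.Vertex} (a : Γ.HomotopyClass p v) (e : Step v w) :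
    (⟨v, a⟩ : Γ.CoverVertex p) = ⟨w, a ≫ stepClass e⟩ ∨
      (Γ.universalCover p).Adj ⟨v, a⟩ ⟨w, a ≫ stepClass e⟩ := by
  refine or_iff_not_imp_left.2 fun hne => ?_
  rw [universalCover, SimpleGraph.fromRel_adj]
  refine ⟨hne, ?_⟩
  obtain e | e := e
  · exact Or.inl ⟨e, rfl⟩
  · refine Or.inr ⟨e, ?_⟩
    rw [← stepClass_inl, Category.assoc]
    exact (congrArg (a ≫ ·) (stepClass_comp_flip (Sum.inr e : Step v w))).trans
      (Category.comp_id a)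

theorem exists_walk_of_path {v : Γ.Vertex} (γ : Γ.EdgePath p v) :
    ∃ q : (Γ.universalCover p).Walk ⟨p, 𝟙 _⟩ ⟨v, pathClass γ⟩,
      q.length ≤ (MarkedGraph.pathCode γ).length := by
  induction γ using edgePath_induction with
  | nil => exact ⟨SimpleGraph.Walk.nil, le_rfl⟩
  | snoc γ e ih =>
    obtain ⟨q, hq⟩ := ih
    rw [pathClass_snoc, pathCode_snoc, List.length_append, List.length_singleton]
    rcases eq_or_adj_comp_stepClass (pathClass γ) e with h1 | h1
    · rw [← h1]
      exact ⟨q, by omega⟩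
    · exact ⟨q.concat h1, by rw [SimpleGraph.Walk.length_concat]; omega⟩

theorem connected_universalCover : (Γ.universalCover p).Connected := by
  have h : ∀ x : Γ.CoverVertex p, (Γ.universalCover p).Reachable ⟨p, 𝟙 _⟩ x := by
    rintro ⟨v, a⟩
    obtain ⟨γ, rfl⟩ := exists_pathClass_eq a
    obtain ⟨q, -⟩ := exists_walk_of_path γ
    exact ⟨q⟩
  have : Nonempty (Γ.CoverVertex p) := ⟨⟨p, 𝟙 _⟩⟩
  exact SimpleGraph.Connected.mk fun x y => (h x).symm.trans (h y)

theorem norm_readClass_le {x y : Γ.CoverVertex p} (q : (Γ.universalCover p).Walk x y) :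
    ((readClass x.2)⁻¹ * readClass y.2).norm ≤ q.length := by
  induction q with
  | nil => simp
  | @cons x z y h q ih =>
    rw [universalCover, SimpleGraph.fromRel_adj] at h
    have h1 : ((readClass x.2)⁻¹ * readClass z.2).norm = 1 := by
      obtain ⟨-, ⟨e, he⟩ | ⟨e, he⟩⟩ := h
      · rw [← he, readClass_comp, readClass_edgeClass, inv_mul_cancel_left, FreeGroup.norm_of]
      · rw [← he, readClass_comp, readClass_edgeClass, mul_inv_rev, inv_mul_cancel_right,
          FreeGroup.norm_inv_eq, FreeGroup.norm_of]
    have h2 := FreeGroup.norm_mul_le ((readClass x.2)⁻¹ * readClass z.2)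
      ((readClass z.2)⁻¹ * readClass y.2)
    rw [show (readClass x.2)⁻¹ * readClass z.2 * ((readClass z.2)⁻¹ * readClass y.2) =
      (readClass x.2)⁻¹ * readClass y.2 by group] at h2
    rw [SimpleGraph.Walk.length_cons]
    omega

/-- A reduced edge-path bounds the distance from above; for the lower bound, each edge of the cover
changes `readClass` by a single letter. -/
theorem dist_universalCover {v : Γ.Vertex} (a : Γ.HomotopyClass p v) :
    (Γ.universalCover p).dist ⟨p, 𝟙 _⟩ ⟨v, a⟩ = (readClass a).norm := by
  refine le_antisymm ?_ ?_
  · obtain ⟨γ, rfl⟩ := exists_pathClass_eq a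
    obtain ⟨δ, h1, h2⟩ := exists_isReduced_pathCode γ
    obtain ⟨q, hq⟩ := exists_walk_of_path δ
    rw [← h1, readClass_pathClass, FreeGroup.norm, FreeGroup.toWord_mk, h2.reduce_eq]
    exact (SimpleGraph.dist_le q).trans hq
  · obtain ⟨q, hq⟩ := (connected_universalCover (p := p)).exists_walk_length_eq_dist
      ⟨p, 𝟙 _⟩ ⟨v, a⟩
    rw [← hq]
    have h := norm_readClass_le q
    have h1 : readClass (𝟙 ((Quiver.FreeGroupoid.of Γ.Vertex).obj p)) = 1 := rfl
    rwa [h1, inv_one, one_mul] at h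

end FiniteGraph

/-! ### The edge homomorphism and its left inverse -/

namespace MarkedGraph

open FiniteGraph

variable {k : ℕ} (M : MarkedGraph k)

/-- The homomorphism from `F` to the free group on the edges of the graph. -/
noncomputable def edgeHom : FreeGroup (Fin k) →* FreeGroup ℕ :=
  FreeGroup.lift fun i => FreeGroup.mk (pathCode (M.loop i))

theorem edgeHom_apply (g : FreeGroup (Fin k)) : M.edgeHom g = readClass (M.marking g) := by
  let r : M.graph.FundamentalGroup M.base →* FreeGroup ℕ :=
    MonoidHom.mk' readClass fun a b => readClass_comp a b
  have : M.edgeHom = r.comp M.marking.toMonoidHom := by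
    refine FreeGroup.ext_hom _ _ fun i => ?_
    rw [edgeHom, FreeGroup.lift_apply_of]
    exact (congrArg readClass (FreeGroup.lift_apply_of
      (f := fun i => (pathClass (M.loop i) : M.graph.FundamentalGroup M.base)))).symm
  rw [this]
  rfl

theorem dist_action (g : FreeGroup (Fin k)) :
    (M.graph.universalCover M.base).dist ⟨M.base, 𝟙 _⟩ (M.action g ⟨M.base, 𝟙 _⟩) =
      (M.edgeHom g).norm := by
  rw [edgeHom_apply, ← dist_universalCover]
  change SimpleGraph.dist _ _ (⟨M.base, M.marking g ≫ 𝟙 _⟩ : M.graph.CoverVertex M.base) = _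
  rw [Category.comp_id]

theorem isActionStretchingFactor_action {hk : 2 ≤ k} {lam : ℝ}
    (h : IsGenericStretchingFactor hk (fun g => (M.edgeHom g).norm) lam) :
    IsActionStretchingFactor hk M.action lam := by
  refine isActionStretchingFactor_of_basePoint M.action connected_universalCover ⟨M.base, 𝟙 _⟩ ?_
  simpa only [dist_action] using h

/-- The homomorphism to the free group on the edges has a left inverse. -/
theorem exists_leftInverse_edgeHom :
    ∃ R : ℕ → FreeGroup (Fin k), (∀ e, M.graph.numEdges ≤ e → R e = 1) ∧
      ∀ i, FreeGroup.lift R (FreeGroup.mk (pathCode (M.loop i))) = FreeGroup.of i := by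
  -- Connecting classes need not come from a spanning tree. Closing an edge up by them defines the
  -- left inverse; the normalisation at the base-vertex makes it exact on closed paths there.
  obtain ⟨τ, hτ⟩ : ∃ τ : ∀ v, M.graph.HomotopyClass M.base v, τ M.base = 𝟙 _ := by
    let σ : ∀ v, M.graph.HomotopyClass M.base v := fun v =>
      pathClass (M.connected.2 M.base v).some
    exact ⟨fun v => Groupoid.inv (σ M.base) ≫ σ v, Groupoid.inv_comp _⟩
  let s : M.graph.FundamentalGroup M.base →* FreeGroup (Fin k) := M.marking.symm.toMonoidHom
  let A : ∀ {u v : M.graph.Vertex}, M.graph.HomotopyClass u v → FreeGroup (Fin k) :=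
    fun {u v} a => s (τ u ≫ a ≫ Groupoid.inv (τ v))
  have hA : ∀ {u v w : M.graph.Vertex} (a : M.graph.HomotopyClass u v)
      (b : M.graph.HomotopyClass v w), A (a ≫ b) = A a * A b := by
    intro u v w a b
    rw [← map_mul]
    change s _ = s ((τ u ≫ a ≫ Groupoid.inv (τ v)) ≫ (τ v ≫ b ≫ Groupoid.inv (τ w)))
    congr 1
    simp
  let R : ℕ → FreeGroup (Fin k) := fun e =>
    if h : e < M.graph.numEdges then
      A (edgeClass (Γ := M.graph) (u := M.graph.src ⟨e, h⟩) (v := M.graph.tgt ⟨e, h⟩)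
        ⟨⟨e, h⟩, rfl, rfl⟩)
    else 1
  have hpos : ∀ {u v : M.graph.Vertex} (e : u ⟶ v), R (e.1 : Fin M.graph.numEdges).1 =
      A (edgeClass e) := by
    rintro u v ⟨e, rfl, rfl⟩
    exact dif_pos e.2
  have hR : ∀ {u v : M.graph.Vertex} (γ : M.graph.EdgePath u v),
      FreeGroup.lift R (FreeGroup.mk (pathCode γ)) = A (pathClass γ) := by
    intro u v γ
    have hone : ∀ u : M.graph.Vertex, A (𝟙 ((Quiver.FreeGroupoid.of M.graph.Vertex).obj u)) = 1 := by
      intro u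
      have := hA (𝟙 ((Quiver.FreeGroupoid.of M.graph.Vertex).obj u)) (𝟙 _)
      rw [Category.comp_id] at this
      exact left_eq_mul.1 this
    induction γ using edgePath_induction with
    | nil => exact (map_one (FreeGroup.lift R)).trans (hone u).symm
    | @snoc v w γ e ih =>
      rw [pathClass_snoc, hA, pathCode_snoc, ← FreeGroup.mul_mk, map_mul, ih]
      congr 1
      obtain e | e := e
      · exact (FreeGroup.lift_apply_of).trans (hpos e)
      · have h1 : (FreeGroup.mk [edgeCode (Sum.inr e : Step v w)] : FreeGroup ℕ) =
            (FreeGroup.of (e.1 : Fin M.graph.numEdges).1)⁻¹ := FreeGroup.mk_singleton_false _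
        rw [h1, map_inv, FreeGroup.lift_apply_of, hpos e, inv_eq_iff_mul_eq_one, ← hA,
          ← stepClass_inl]
        exact (congrArg A (stepClass_comp_flip (Sum.inl e : Step w v))).trans (hone w)
  refine ⟨R, fun e he => dif_neg (by omega), fun i => ?_⟩
  rw [hR]
  change s (τ M.base ≫ pathClass (M.loop i) ≫ Groupoid.inv (τ M.base)) = _
  have h1 : Groupoid.inv (τ M.base) = 𝟙 _ := by
    have := Groupoid.inv_comp (τ M.base)
    rw [hτ, Category.comp_id] at this
    rw [hτ]
    exact this
  rw [h1, hτ, Category.id_comp, Category.comp_id]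
  change M.marking.symm _ = _
  rw [MulEquiv.symm_apply_eq]
  exact FreeGroup.lift_apply_of.symm

end MarkedGraph

/-! ### The algorithm -/

namespace StretchingAlgorithm

/-- The word obtained by replacing the letters of `w` by the words in the table `T`. -/
def substWord (T : List (List (ℕ × Bool))) (w : List (ℕ × Bool)) : List (ℕ × Bool) :=
  w.flatMap fun a => bif a.2 then T.getD a.1 [] else FreeGroup.invRev (T.getD a.1 [])

/-- The lists of length `n` of the letters `(i, ±)` with `i < k`. -/
def allWords (k : ℕ) : ℕ → List (List (ℕ × Bool))
  | 0 => [[]]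
  | n + 1 => ((List.range k).flatMap fun i => [(i, true), (i, false)]).flatMap fun a =>
      (allWords k n).map fun w => a :: w

/-- The reduced words of length `n` in the letters `(i, ±)` with `i < k`. -/
def reducedList (k n : ℕ) : List (List (ℕ × Bool)) :=
  (allWords k n).filter fun w => FreeGroup.reduce w = w

/-- The sum of the lengths of the reduced images of some words. -/
def totalLength (T : List (List (ℕ × Bool))) (L : List (List (ℕ × Bool))) : ℕ :=
  (L.map fun w => (FreeGroup.reduce (substWord T w)).length).sum

/-- The words in `R` define a left inverse of the homomorphism which is defined by the words
in `T`. -/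
def IsLeftInverse (T R : List (List (ℕ × Bool))) : Prop :=
  (T.map fun w => FreeGroup.reduce (substWord R w)) =
    (List.range T.length).map fun i => [(i, true)]

instance (T R : List (List (ℕ × Bool))) : Decidable (IsLeftInverse T R) :=
  inferInstanceAs (Decidable (_ = _))

/-- The length of the prefixes which have to be inspected. -/
def prefixLength (T R : List (List (ℕ × Bool))) : ℕ := R.flatten.length * T.flatten.length + 1

/-- Numerator and denominator of the stretching factor. -/
def output (T R : List (List (ℕ × Bool))) : ℕ × ℕ :=
  (totalLength T (reducedList T.length (prefixLength T R + 1)) -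
      totalLength T ((reducedList T.length (prefixLength T R + 1)).map List.tail),
    (reducedList T.length (prefixLength T R + 1)).length)

/-- One step of the search for a left inverse. -/
def searchStep (c : MarkedGraph.Code) (n : ℕ) : Option (ℕ × ℕ) :=
  (Encodable.decode (α := List (List (ℕ × Bool))) n).bind fun R =>
    if IsLeftInverse c.2.2.2 R then some (output c.2.2.2 R) else none

/-- Search for a left inverse, and compute the stretching factor with its help. -/
def algorithm (c : MarkedGraph.Code) : Part (ℕ × ℕ) := Nat.rfindOpt (searchStep c)

/-! ### Primitive recursive ingredients -/

section Computability

open Primrec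

theorem primrec_invRev : Primrec (FreeGroup.invRev : List (ℕ × Bool) → List (ℕ × Bool)) := by
  unfold FreeGroup.invRev
  exact list_reverse.comp (list_map .id
    ((fst.comp snd).pair (Primrec.not.comp (snd.comp snd))).to₂)

/-- Presents free reduction as a right fold, the form in which primitive recursiveness is available.
-/
theorem reduce_eq_foldr (w : List (ℕ × Bool)) :
    FreeGroup.reduce w = w.foldr (fun a l =>
      List.casesOn l [a] fun b t => if a.1 = b.1 ∧ a.2 = !b.2 then t else a :: b :: t) [] := by
  induction w with
  | nil => rfl
  | cons a w ih => rw [FreeGroup.reduce.cons, List.foldr_cons, ih]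

theorem primrec_reduce :
    Primrec (FreeGroup.reduce : List (ℕ × Bool) → List (ℕ × Bool)) := by
  have h1 : Primrec₂ fun (x : (ℕ × Bool) × List (ℕ × Bool)) (y : (ℕ × Bool) × List (ℕ × Bool)) =>
      if x.1.1 = y.1.1 ∧ x.1.2 = !y.1.2 then y.2 else x.1 :: y.1 :: y.2 := by
    refine Primrec.ite (PrimrecPred.and ?_ ?_) (snd.comp snd) ?_
    · exact Primrec.eq.comp (fst.comp (fst.comp fst)) (fst.comp (fst.comp snd))
    · exact Primrec.eq.comp (snd.comp (fst.comp fst)) (Primrec.not.comp (snd.comp (fst.comp snd)))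
    · exact list_cons.comp (fst.comp fst) (list_cons.comp (fst.comp snd) (snd.comp snd))
  have h2 : Primrec fun x : (ℕ × Bool) × List (ℕ × Bool) =>
      (List.casesOn x.2 [x.1] fun b t =>
        if x.1.1 = b.1 ∧ x.1.2 = !b.2 then t else x.1 :: b :: t : List (ℕ × Bool)) :=
    list_casesOn snd (list_cons.comp fst (const [])) h1
  refine (list_foldr .id (const []) (h2.comp snd).to₂).of_eq fun w => ?_
  exact (reduce_eq_foldr w).symm

theorem primrec_substWord : Primrec₂ substWord := by
  unfold substWord
  refine list_flatMap snd ?_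
  have h : Primrec fun x : (List (List (ℕ × Bool)) × List (ℕ × Bool)) × ℕ × Bool =>
      x.1.1.getD x.2.1 [] := (list_getD []).comp (fst.comp fst) (fst.comp snd)
  exact Primrec.cond (snd.comp snd) h (primrec_invRev.comp h)

theorem primrec_allWords : Primrec₂ allWords := by
  have h1 : Primrec fun k : ℕ => (List.range k).flatMap fun i => [(i, true), (i, false)] :=
    list_flatMap list_range (list_cons.comp (snd.pair (const true))
      (list_cons.comp (snd.pair (const false)) (const []))).to₂
  have h2 : Primrec₂ fun (k : ℕ) (x : ℕ × List (List (ℕ × Bool))) =>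
      ((List.range k).flatMap fun i => [(i, true), (i, false)]).flatMap fun a =>
        x.2.map fun w => a :: w :=
    list_flatMap (h1.comp fst) (list_map (snd.comp (snd.comp fst))
      (list_cons.comp (snd.comp fst) snd).to₂).to₂
  refine (nat_rec (const [[]]) h2).of_eq fun k n => ?_
  induction n with
  | zero => rfl
  | succ n ih =>
    simp only [allWords] at *
    rw [ih]

theorem primrec_reducedList : Primrec₂ reducedList := by
  have h : PrimrecPred fun w : List (ℕ × Bool) => FreeGroup.reduce w = w :=
    Primrec.eq.comp primrec_reduce .id
  exact (Primrec.listFilter h).comp₂ primrec_allWords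

theorem primrec_totalLength : Primrec₂ totalLength := by
  have h1 : Primrec₂ fun (x : List (List (ℕ × Bool)) × List (List (ℕ × Bool)))
      (w : List (ℕ × Bool)) => (FreeGroup.reduce (substWord x.1 w)).length :=
    list_length.comp (primrec_reduce.comp (primrec_substWord.comp (fst.comp fst) snd))
  refine (list_foldr (list_map snd h1) (const 0)
    (nat_add.comp (fst.comp snd) (snd.comp snd)).to₂).of_eq fun x => ?_
  rfl

theorem primrecRel_isLeftInverse : PrimrecRel IsLeftInverse := by
  refine Primrec.eq.comp ?_ ?_
  · exact list_map fst (primrec_reduce.comp (primrec_substWord.comp (snd.comp fst) snd)).to₂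
  · exact list_map (list_range.comp (list_length.comp fst))
      (list_cons.comp (snd.pair (const true)) (const [])).to₂

theorem primrec_output : Primrec₂ output := by
  have h1 : Primrec₂ prefixLength :=
    succ.comp (nat_mul.comp (list_length.comp (list_flatten.comp snd))
      (list_length.comp (list_flatten.comp fst)))
  have h2 : Primrec fun x : List (List (ℕ × Bool)) × List (List (ℕ × Bool)) =>
      reducedList x.1.length (prefixLength x.1 x.2 + 1) :=
    primrec_reducedList.comp (list_length.comp fst) (succ.comp h1)
  exact (nat_sub.comp (primrec_totalLength.comp fst h2)
    (primrec_totalLength.comp fst (list_map h2 (list_tail.comp snd).to₂))).pair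
      (list_length.comp h2)

theorem primrec_searchStep : Primrec₂ searchStep := by
  have h : Primrec fun c : MarkedGraph.Code => c.2.2.2 := snd.comp (snd.comp snd)
  refine option_bind (Primrec.decode.comp snd) ?_
  have h1 : Primrec fun x : (MarkedGraph.Code × ℕ) × List (List (ℕ × Bool)) => x.1.1.2.2.2 :=
    h.comp (fst.comp fst)
  exact Primrec.ite (primrecRel_isLeftInverse.comp h1 snd)
    (option_some.comp (primrec_output.comp h1 snd)) (const none)

theorem partrec_algorithm : Partrec algorithm := Partrec.rfindOpt primrec_searchStep.to_comp

end Computability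

/-! ### Correctness of the algorithm -/

section Correctness

variable {k : ℕ}

/-- Words in the generators `a₁, …, a_k` as words in numbered letters. -/
def numbered (w : List (Fin k × Bool)) : List (ℕ × Bool) := w.map fun a => (a.1.1, a.2)

theorem numbered_injective : Function.Injective (numbered (k := k)) :=
  List.map_injective_iff.2 fun a b h => by
    simp only [Prod.mk.injEq] at h
    exact Prod.ext (Fin.ext h.1) h.2

theorem mk_numbered (w : List (Fin k × Bool)) :
    FreeGroup.mk (numbered w) = FreeGroup.map Fin.val (FreeGroup.mk w) := by
  rw [FreeGroup.map.mk]
  rfl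

theorem mk_substWord (T : List (List (ℕ × Bool))) (w : List (ℕ × Bool)) :
    FreeGroup.mk (substWord T w) =
      FreeGroup.lift (fun i => FreeGroup.mk (T.getD i [])) (FreeGroup.mk w) := by
  induction w with
  | nil => exact (map_one _).symm
  | cons a w ih =>
    rw [substWord, List.flatMap_cons, ← FreeGroup.mul_mk]
    rw [substWord] at ih
    rw [ih, ← List.singleton_append, ← FreeGroup.mul_mk, map_mul]
    congr 1
    obtain ⟨i, s⟩ := a
    cases s
    · rw [FreeGroup.mk_singleton_false, map_inv, FreeGroup.lift_apply_of, FreeGroup.inv_mk]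
      rfl
    · exact FreeGroup.lift_apply_of.symm

theorem mem_allWords {n : ℕ} {w : List (ℕ × Bool)} :
    w ∈ allWords k n ↔ w.length = n ∧ ∀ a ∈ w, a.1 < k := by
  induction n generalizing w with
  | zero =>
    rw [allWords, List.mem_singleton, List.length_eq_zero_iff]
    constructor
    · rintro rfl
      simp
    · exact fun h => h.1
  | succ n ih =>
    cases w with
    | nil => simp [allWords]
    | cons a w =>
      obtain ⟨i, s⟩ := a
      cases s <;> simp [allWords, ih, and_left_comm]

theorem nodup_allWords (k n : ℕ) : (allWords k n).Nodup := by
  induction n with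
  | zero => simp [allWords]
  | succ n ih =>
    rw [allWords, List.nodup_flatMap]
    refine ⟨fun a _ => ih.map List.cons_injective, ?_⟩
    have h : ((List.range k).flatMap fun i => [(i, true), (i, false)]).Nodup := by
      rw [List.nodup_flatMap]
      refine ⟨fun i _ => by simp, List.nodup_range.imp ?_⟩
      intro i j hij
      simp [Function.onFun, List.disjoint_left, hij]
    refine h.imp ?_
    intro a b hab
    simp only [Function.onFun, List.disjoint_left, List.mem_map]
    rintro _ ⟨w, _, rfl⟩ ⟨v, _, h⟩
    exact hab (List.cons.inj h).1.symm

theorem isReduced_numbered {w : List (Fin k × Bool)} :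
    FreeGroup.IsReduced (numbered w) ↔ FreeGroup.IsReduced w := by
  unfold FreeGroup.IsReduced numbered
  rw [List.isChain_map]
  simp only [Fin.val_inj]

theorem toFinset_reducedList (k n : ℕ) :
    (reducedList k (n + 1)).toFinset = (FreeGroup.reducedWords k n).image numbered := by
  ext w
  simp only [reducedList, List.mem_toFinset, List.mem_filter, mem_allWords, decide_eq_true_eq,
    Finset.mem_image, FreeGroup.mem_reducedWords]
  constructor
  · rintro ⟨⟨h1, h2⟩, h3⟩
    obtain ⟨v, rfl⟩ : ∃ v : List (Fin k × Bool), numbered v = w := by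
      refine ⟨w.attach.map fun a => (⟨a.1.1, h2 a.1 a.2⟩, a.1.2), ?_⟩
      rw [numbered, List.map_map]
      exact (List.map_congr_left fun _ _ => rfl).trans (List.attach_map_subtype_val w)
    refine ⟨v, ⟨?_, by simpa [numbered] using h1⟩, rfl⟩
    rwa [← FreeGroup.isReduced_iff_reduce_eq, isReduced_numbered] at h3
  · rintro ⟨v, ⟨h1, h2⟩, rfl⟩
    refine ⟨⟨by simpa [numbered] using h2, ?_⟩, ?_⟩
    · simp only [numbered, List.mem_map, forall_exists_index, and_imp]
      rintro _ a _ rfl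
      exact a.1.2
    · rwa [← FreeGroup.isReduced_iff_reduce_eq, isReduced_numbered]

theorem sum_reducedList (n : ℕ) (f : List (ℕ × Bool) → ℕ) :
    ((reducedList k (n + 1)).map f).sum = ∑ w ∈ FreeGroup.reducedWords k n, f (numbered w) := by
  have hn : (reducedList k (n + 1)).Nodup := (nodup_allWords k (n + 1)).filter _
  rw [← List.sum_toFinset f hn, toFinset_reducedList, Finset.sum_image numbered_injective.injOn]

variable (M : MarkedGraph k)

theorem getD_code (i : Fin k) : M.code.2.2.2.getD i [] = MarkedGraph.pathCode (M.loop i) := by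
  change (List.ofFn fun i => MarkedGraph.pathCode (M.loop i)).getD i [] = _
  simp [List.getD]

theorem length_code : M.code.2.2.2.length = k := List.length_ofFn

theorem getElem_code (i : ℕ) (hi : i < M.code.2.2.2.length) :
    M.code.2.2.2[i] = MarkedGraph.pathCode (M.loop ⟨i, by rwa [length_code] at hi⟩) :=
  List.getElem_ofFn _

theorem mk_substWord_code (w : List (Fin k × Bool)) :
    FreeGroup.mk (substWord M.code.2.2.2 (numbered w)) = M.edgeHom (FreeGroup.mk w) := by
  rw [mk_substWord, mk_numbered]
  have h : (FreeGroup.lift fun i => FreeGroup.mk (M.code.2.2.2.getD i [])).comp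
      (FreeGroup.map Fin.val) = M.edgeHom := FreeGroup.ext_hom _ _ fun i => ?_
  · exact DFunLike.congr_fun h (FreeGroup.mk w)
  rw [MonoidHom.comp_apply, FreeGroup.map.of, FreeGroup.lift_apply_of, getD_code,
    MarkedGraph.edgeHom, FreeGroup.lift_apply_of]

theorem length_reduce_substWord (w : List (Fin k × Bool)) :
    (FreeGroup.reduce (substWord M.code.2.2.2 (numbered w))).length =
      (M.edgeHom (FreeGroup.mk w)).norm := by
  rw [← FreeGroup.toWord_mk, mk_substWord_code, FreeGroup.norm]

theorem norm_mk_getD_le (T : List (List (ℕ × Bool))) (i : ℕ) :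
    (FreeGroup.mk (T.getD i [])).norm ≤ T.flatten.length := by
  refine FreeGroup.norm_mk_le.trans ?_
  by_cases h : i < T.length
  · rw [List.getD_eq_getElem _ _ h]
    exact (List.sublist_flatten_of_mem (List.getElem_mem h)).length_le
  · rw [List.getD_eq_default _ _ (not_lt.1 h)]
    exact Nat.zero_le _

theorem lift_edgeHom_of_isLeftInverse {R : List (List (ℕ × Bool))}
    (h : IsLeftInverse M.code.2.2.2 R) (g : FreeGroup (Fin k)) :
    FreeGroup.lift (fun i => FreeGroup.mk (R.getD i [])) (M.edgeHom g) =
      FreeGroup.map Fin.val g := by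
  have key : (FreeGroup.lift fun i => FreeGroup.mk (R.getD i [])).comp M.edgeHom =
      FreeGroup.map Fin.val := FreeGroup.ext_hom _ _ fun i => ?_
  · exact DFunLike.congr_fun key g
  have h1 := List.getElem_of_eq h (i := i) (by simp [length_code])
  rw [List.getElem_map, List.getElem_map, List.getElem_range, getElem_code] at h1
  rw [MonoidHom.comp_apply, MarkedGraph.edgeHom, FreeGroup.lift_apply_of, ← mk_substWord,
    ← FreeGroup.reduce.self, h1, FreeGroup.map.of]
  rfl

theorem isGenericStretchingFactor_output (hk : 2 ≤ k) {R : List (List (ℕ × Bool))}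
    (h : IsLeftInverse M.code.2.2.2 R) :
    (output M.code.2.2.2 R).2 ≠ 0 ∧ IsActionStretchingFactor hk M.action
      (((output M.code.2.2.2 R).1 : ℝ) / ((output M.code.2.2.2 R).2 : ℝ)) := by
  set c := M.edgeHom
  set C := R.flatten.length
  set D := M.code.2.2.2.flatten.length
  set m := prefixLength M.code.2.2.2 R with hm_def
  have hD : ∀ i, (c (.of i)).norm ≤ D := by
    intro i
    have := norm_mk_getD_le M.code.2.2.2 i
    rw [getD_code] at this
    exact (congrArg FreeGroup.norm FreeGroup.lift_apply_of).trans_le this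
  -- The left inverse stretches lengths by at most C, the total length of the words in R. It lands
  -- in the free group on ℕ, so a left inverse of `Fin.val` brings the result back without
  -- lengthening it.
  have hnorm : ∀ g, g.norm ≤ C * (c g).norm := by
    intro g
    have : Nonempty (Fin k) := ⟨⟨0, by omega⟩⟩
    have h1 : FreeGroup.map (Function.invFun Fin.val) (FreeGroup.map Fin.val g) = g := by
      rw [FreeGroup.map.comp, Function.invFun_comp Fin.val_injective, FreeGroup.map.id]
    have h2 := FreeGroup.norm_map_le (FreeGroup.map (Function.invFun (Fin.val : Fin k → ℕ)))
      (D := 1) (fun i => by simp) (FreeGroup.map Fin.val g)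
    rw [h1, one_mul, ← lift_edgeHom_of_isLeftInverse M h] at h2
    refine h2.trans (FreeGroup.norm_map_le _ (fun i => ?_) _)
    rw [FreeGroup.lift_apply_of]
    exact norm_mk_getD_le R i
  have hm : ∀ g : FreeGroup (Fin k), m ≤ g.norm → D < (c g).norm := by
    intro g hg
    by_contra! hlt
    have h1 := hnorm g
    have h2 : C * (c g).norm ≤ C * D := Nat.mul_le_mul_left C hlt
    have h3 : m = C * D + 1 := rfl
    omega
  have hinj : Function.Injective c := by
    rw [injective_iff_map_eq_one]
    intro g hg
    have := hnorm g
    rwa [hg, FreeGroup.norm_one, mul_zero, Nat.le_zero, FreeGroup.norm_eq_zero] at this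
  have h1 := isGenericStretchingFactor_norm_map hk c hD hm
  have h2 := FreeGroup.one_le_averageIncrement hk hinj hD hm
  have hq := FreeGroup.three_le_two_mul_sub_one hk
  have hkR : (2 : ℝ) ≤ k := by exact_mod_cast hk
  have hden : (0 : ℝ) < 2 * k * (2 * k - 1) ^ m := by positivity
  rw [FreeGroup.averageIncrement_eq_div m fun w => (c (FreeGroup.mk w)).norm] at h1 h2
  have e2 : (((output M.code.2.2.2 R).2 : ℕ) : ℝ) = 2 * k * (2 * k - 1) ^ m := by
    rw [← FreeGroup.card_reducedWords hk m]
    congr 1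
    have := sum_reducedList (k := k) m fun _ => 1
    simp only [List.map_const', List.sum_replicate, smul_eq_mul, mul_one, Finset.sum_const] at this
    simp only [output, length_code]
    exact this
  have e1 : ∀ L, totalLength M.code.2.2.2 L =
    (L.map fun w => (FreeGroup.reduce (substWord M.code.2.2.2 w)).length).sum := fun _ => rfl
  have e3 : (output M.code.2.2.2 R).1 =
      ∑ w ∈ FreeGroup.reducedWords k m, (c (FreeGroup.mk w)).norm -
        ∑ w ∈ FreeGroup.reducedWords k m, (c (FreeGroup.mk w.tail)).norm := by
    simp only [output, length_code, e1, List.map_map]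
    rw [← hm_def, sum_reducedList, sum_reducedList]
    congr 1
    · exact Finset.sum_congr rfl fun w _ => length_reduce_substWord M w
    · refine Finset.sum_congr rfl fun w _ => ?_
      rw [← length_reduce_substWord M w.tail]
      simp [numbered, List.map_tail]
  -- The subtraction in ℕ is not truncated, since the stretching factor is at least 1 and the
  -- difference therefore non-negative.
  have e4 : (((output M.code.2.2.2 R).1 : ℕ) : ℝ) =
      ((∑ w ∈ FreeGroup.reducedWords k m, ((c (FreeGroup.mk w)).norm : ℤ) -
        ∑ w ∈ FreeGroup.reducedWords k m, ((c (FreeGroup.mk w.tail)).norm : ℤ) : ℤ) : ℝ) := by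
    rw [le_div_iff₀ hden, one_mul] at h2
    have h3 := hden.le.trans h2
    rw [Int.cast_nonneg_iff, sub_nonneg] at h3
    rw [e3, Nat.cast_sub (by exact_mod_cast h3)]
    push_cast
    rfl
  refine ⟨?_, ?_⟩
  · intro h0
    rw [h0] at e2
    simp only [Nat.cast_zero] at e2
    linarith
  · rw [e4, e2]
    exact M.isActionStretchingFactor_action h1

theorem exists_isLeftInverse : ∃ R, IsLeftInverse M.code.2.2.2 R := by
  obtain ⟨R, hR, h⟩ := M.exists_leftInverse_edgeHom
  refine ⟨(List.range M.graph.numEdges).map fun e => (FreeGroup.map Fin.val (R e)).toWord, ?_⟩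
  have h1 : ∀ e, FreeGroup.mk (((List.range M.graph.numEdges).map fun e =>
      (FreeGroup.map Fin.val (R e)).toWord).getD e []) = FreeGroup.map Fin.val (R e) := by
    intro e
    by_cases he : e < M.graph.numEdges
    · simp [List.getD, he, FreeGroup.mk_toWord]
    · rw [hR e (not_lt.1 he), map_one, List.getD_eq_default _ _ (by simpa using he)]
      rfl
  unfold IsLeftInverse
  rw [length_code]
  apply List.ext_getElem (by simp [length_code])
  intro i hi hi'
  rw [List.getElem_map, List.getElem_map, List.getElem_range, ← FreeGroup.toWord_mk, mk_substWord]
  simp only [h1]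
  rw [getElem_code]
  have h3 : FreeGroup.lift (fun e => FreeGroup.map Fin.val (R e)) =
      (FreeGroup.map (Fin.val : Fin k → ℕ)).comp (FreeGroup.lift R) :=
    FreeGroup.ext_hom _ _ fun e => by simp
  rw [h3, MonoidHom.comp_apply, h, FreeGroup.map.of, FreeGroup.toWord_of]

theorem algorithm_correct (hk : 2 ≤ k) : ∃ a b : ℕ, (a, b) ∈ algorithm M.code ∧ b ≠ 0 ∧
    IsActionStretchingFactor hk M.action ((a : ℝ) / (b : ℝ)) := by
  obtain ⟨R, hR⟩ := exists_isLeftInverse M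
  have hdom : (algorithm M.code).Dom := by
    refine Nat.rfindOpt_dom.2 ⟨Encodable.encode R, output M.code.2.2.2 R, ?_⟩
    simp [searchStep, hR]
  have hmem := Part.get_mem hdom
  -- The left inverse found by the search may differ from the one known to exist; any left inverse
  -- yields a correct output.
  obtain ⟨n, hn⟩ := Nat.rfindOpt_spec hmem
  rw [searchStep, Option.mem_def, Option.bind_eq_some_iff] at hn
  obtain ⟨R', -, hR'⟩ := hn
  split_ifs at hR' with h
  have h1 := isGenericStretchingFactor_output M hk h
  rw [Option.some.inj hR'] at h1
  exact ⟨_, _, hmem, h1.1, h1.2⟩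

end Correctness

end StretchingAlgorithm

theorem mainTheorem1 :
    (∀ (k : ℕ) (hk : 2 ≤ k) (V : Type*) (X : SimpleGraph V) (φ : FreeGroup (Fin k) →* (X ≃g X)),
      X.IsTree → IsFreeAction φ → WithoutInversions φ →
        ∃ lam : ℚ, IsActionStretchingFactor hk φ (lam : ℝ) ∧ 1 ≤ lam ∧
          2 * (k : ℚ) * lam ∈ Algebra.adjoin ℤ {(1 / (2 * (k : ℚ) - 1))}) ∧
    (∃ f : MarkedGraph.Code →. ℕ × ℕ, Partrec f ∧
      ∀ (k : ℕ) (hk : 2 ≤ k) (M : MarkedGraph k), ∃ a b : ℕ, (a, b) ∈ f M.code ∧ b ≠ 0 ∧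
        IsActionStretchingFactor hk M.action ((a : ℝ) / (b : ℝ))) :=
  ⟨fun _ hk _ _ φ hX hfree hinv => exists_isActionStretchingFactor hk φ hX hfree hinv,
    StretchingAlgorithm.algorithm, StretchingAlgorithm.partrec_algorithm,
    fun _ hk M => StretchingAlgorithm.algorithm_correct M hk⟩
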